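/- **Theorem 7.1.** Let $K$ be a number field, let $V_K^f$ be its set of non-archimedean places, and for $v\in V_K^f$ let $\mathcal O_v\subseteq K_v$ be the completion with its valuation ring. *Data.* Let $L$ be a many-sorted first-order language with a sort $\mathbf K$ (the field sort) carrying the symbols $+,\cdot,0,1$ of the language of rings, and possibly further sorts and symbols. For every $v\in V_K^f$ let an $L$-structure be given whose field sort is $K_v$ with its ring operations; it is again denoted $K_v$. For every sort $\tau\ne\mathbf K$ let $\Phi_\tau(x)$ be an $L$-formula in one variable of sort $\tau$ (for instance $x=x$), and put $S_{\mathbf K,v}=\mathcal O_v$ and $S_{\tau,v}=\{x: K_v\models\Phi_\tau(x)\}$ for $\tau\neq\mathbf K$. Assume that each function symbol of $L$ maps the sets $S_{\tau,v}$ into each other for all but finitely many $v$. Then $\mathbb A_K^{fin}$ denotes the $L$-structure whose sort $\tau$ is the set of all $f\in\prod_{v}\tau(K_v)$ with $f(v)\in S_{\tau,v}$ for all but finitely many $v$ (so the field sort is the ring of finite adeles), where function symbols act componentwise, and a relation holds if and only if it holds at every $v$. For an $L$-formula $\varphi(x_1,\dots,x_n)$ (with variables of any sorts) and $a_1,\dots,a_n\in\mathbb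 A_K^{fin}$ of the corresponding sorts let $$[[\varphi(a_1,\dots,a_n)]]=\{v\in V_K^f: K_v\models\varphi(a_1(v),\dots,a_n(v))\}.$$ Let $\mathcal L$ be a language extending $\{0,1,\wedge,\vee,\bar{\ },Fin\}$, and let $\mathbb P^+$ be an $\mathcal L$-structure on the set of all subsets of $V_K^f$ in which $0,1,\wedge,\vee,\bar{\ }$ are the usual Boolean operations, $Fin(X)$ says that $X$ is finite, and the other symbols are interpreted arbitrarily. *Assumptions.* (a) $\mathbb P^+$ has quantifier elimination: every $\mathcal L$-formula is equivalent in $\mathbb P^+$ to a quantifier-free $\mathcal L$-formula in the same variables. (b) The $K_v$, $v\in V_K^f$, admit uniform quantifier elimination in a sort $\sigma$ of $L$ relative to the other sorts: every $L$-formula is equivalent, in all $K_v$ simultaneously, to an $L$-formula in the same variables that has no quantifiers over the sort $\sigma$. *Conclusion.* (1) For every $L$-formula $\psi(x_1,\dots,x_n)$ there are $m\ge 0$, $L$-formulas $\psi_1(x_1,\dots,x_n),\dots,\psi_m(x_1,\dots,x_n)$ without quantifiers over $\sigma$ and a quantifier-free $\mathcal L$-formula $\theta(X_1,\dots,X_m)$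 such that for all $a_1,\dots,a_n\in\mathbb A_K^{fin}$ of the corresponding sorts $$\mathbb A_K^{fin}\models\psi(a_1,\dots,a_n)\iff \mathbb P^+\models\theta\big([[\psi_1(a_1,\dots,a_n)]],\dots,[[\psi_m(a_1,\dots,a_n)]]\big).$$ (2) Such $\psi_1,\dots,\psi_m,\theta$ are effectively computable from $\psi$, relative to the given data: whenever the sorts and symbols of $L$ and of $\mathcal L$ are numbered by natural numbers and $g,g',h:\mathbb N\to\mathbb N$ are functions that, on Gödel numbers, carry out an elimination as in (b), an elimination as in (a), and the assignment $\tau\mapsto\Phi_\tau$ $(\tau\ne\mathbf K)$, there is a function $f:\mathbb N\to\mathbb N$ that is computable with oracles $g,g',h$ and sends the Gödel number of each formula $\psi(x_1,\dots,x_n)$ (with its list of variables) to a code of a tuple $(\psi_1,\dots,\psi_m;\theta)$ as in (1). -/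

import Mathlib

open scoped RestrictedProduct NumberField
open IsDedekindDomain Filter

universe t u v v' w x

namespace ManySorted

/-- A many-sorted first-order language with set of sorts `S`: function symbols of sort
`as 0 × ⋯ × as (k-1) → τ` and relation symbols of sort `as 0 × ⋯ × as (k-1)`.
Equality on each sort is a logical symbol. A one-sorted language is a `Lang Unit`. -/
structure Lang (S : Type u) where
  Func : {k : ℕ} → (Fin k → S) → S → Type v
  Rel : {k : ℕ} → (Fin k → S) → Type v

variable {S : Type u}

/-- The context with a new variable of sort `τ` put in front (it becomes variable number `0`). -/
abbrev consCtx {n : ℕ} (τ : S) (Γ : Fin n → S) : Fin (n + 1) → S :=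
  Fin.cons (α := fun _ => S) τ Γ

/-- Terms of sort `τ` in variables `x 0, …, x (n-1)` of sorts `Γ 0, …, Γ (n-1)`. -/
inductive Term (L : Lang.{u, v} S) {n : ℕ} (Γ : Fin n → S) : S → Type (max u v)
  | var (i : Fin n) : Term L Γ (Γ i)
  | app {k : ℕ} {as : Fin k → S} {τ : S} (f : L.Func as τ)
      (ts : ∀ i : Fin k, Term L Γ (as i)) : Term L Γ τ

/-- First-order formulas with free variables among `x 0, …, x (n-1)` of sorts
`Γ 0, …, Γ (n-1)`; bound variables are de Bruijn indices. The other connectives and `∃` are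
abbreviations, as usual. -/
inductive Formula (L : Lang.{u, v} S) : {n : ℕ} → (Fin n → S) → Type (max u v)
  | falsum {n : ℕ} {Γ : Fin n → S} : Formula L Γ
  | eq {n : ℕ} {Γ : Fin n → S} {τ : S} (t₁ t₂ : Term L Γ τ) : Formula L Γ
  | rel {n : ℕ} {Γ : Fin n → S} {k : ℕ} {as : Fin k → S} (R : L.Rel as)
      (ts : ∀ i : Fin k, Term L Γ (as i)) : Formula L Γ
  | imp {n : ℕ} {Γ : Fin n → S} (φ₁ φ₂ : Formula L Γ) : Formula L Γ
  | all {n : ℕ} {Γ : Fin n → S} (τ : S) (φ : Formula L (consCtx τ Γ)) : Formula L Γ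

/-- No quantifier over the sort `σ` occurs in the formula (quantifiers over other sorts may).
For a one-sorted language this says that the formula is quantifier-free. -/
def Formula.QuantFreeIn {L : Lang.{u, v} S} (σ : S) :
    {n : ℕ} → {Γ : Fin n → S} → Formula L Γ → Prop
  | _, _, .falsum => True
  | _, _, .eq _ _ => True
  | _, _, .rel _ _ => True
  | _, _, .imp φ₁ φ₂ => φ₁.QuantFreeIn σ ∧ φ₂.QuantFreeIn σ
  | _, _, .all τ φ => τ ≠ σ ∧ φ.QuantFreeIn σ

/-- An interpretation of `L` on a family `M` of sets indexed by the sorts. -/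
structure Struc (L : Lang.{u, v} S) (M : S → Type w) where
  func : {k : ℕ} → {as : Fin k → S} → {τ : S} → L.Func as τ → (∀ i, M (as i)) → M τ
  rel : {k : ℕ} → {as : Fin k → S} → L.Rel as → (∀ i, M (as i)) → Prop

/-- Extend an assignment by a value for the new variable number `0`. -/
def consAssign {M : S → Type w} {n : ℕ} {τ : S} {Γ : Fin n → S} (c : M τ) (a : ∀ i, M (Γ i)) :
    ∀ i, M (consCtx τ Γ i) :=
  Fin.cases c a

/-- The value of a term. -/
def Term.eval {L : Lang.{u, v} S} {M : S → Type w} (s : Struc L M) {n : ℕ} {Γ : Fin n → S}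
    (a : ∀ i, M (Γ i)) : {τ : S} → Term L Γ τ → M τ
  | _, .var i => a i
  | _, .app f ts => s.func f fun i => (ts i).eval s a

/-- Satisfaction of a formula under an assignment of its free variables. -/
def Formula.Realize {L : Lang.{u, v} S} {M : S → Type w} (s : Struc L M) :
    {n : ℕ} → {Γ : Fin n → S} → Formula L Γ → (∀ i, M (Γ i)) → Prop
  | _, _, .falsum, _ => False
  | _, _, .eq t₁ t₂, a => t₁.eval s a = t₂.eval s a
  | _, _, .rel R ts, a => s.rel R fun i => (ts i).eval s a
  | _, _, .imp φ₁ φ₂, a => φ₁.Realize s a → φ₂.Realize s a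
  | _, _, .all τ φ, a => ∀ c : M τ, φ.Realize s (consAssign c a)

/-- The family of `L`-structures admits uniform quantifier elimination in the sort `σ`, relative
to the other sorts: every formula is equivalent, in all members of the family at once, to a formula
in the same variables without quantifiers over `σ`. -/
def UniformQE {L : Lang.{u, v} S} (σ : S) {ι : Type x} {M : ι → S → Type w}
    (s : ∀ i, Struc L (M i)) : Prop :=
  ∀ (n : ℕ) (Γ : Fin n → S) (φ : Formula L Γ), ∃ φ' : Formula L Γ,
    φ'.QuantFreeIn σ ∧ ∀ (i : ι) (a : ∀ j, M i (Γ j)), φ'.Realize (s i) a ↔ φ.Realize (s i) a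

/-! ### Gödel numbers -/

/-- A numbering of the sorts and symbols of a language (so the language is countable). -/
structure Numbering (L : Lang.{u, v} S) where
  sort : S ↪ ℕ
  func : (Σ (k : ℕ) (as : Fin k → S) (τ : S), L.Func as τ) ↪ ℕ
  rel : (Σ (k : ℕ) (as : Fin k → S), L.Rel as) ↪ ℕ

namespace Numbering

variable {L : Lang.{u, v} S} (N : Numbering L)

/-- The code of a context: the list of the codes of the sorts of the variables. -/
def ctxCode {n : ℕ} (Γ : Fin n → S) : ℕ :=
  Encodable.encode (List.ofFn fun i => N.sort (Γ i))

/-- The Gödel number of a term. -/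
def termCode {n : ℕ} {Γ : Fin n → S} : {τ : S} → Term L Γ τ → ℕ
  | _, .var i => Nat.pair 0 i
  | _, .app f ts =>
      Nat.pair 1 (Nat.pair (N.func ⟨_, _, _, f⟩)
        (Encodable.encode (List.ofFn fun i => termCode (ts i))))

/-- The Gödel number of a formula. -/
def code : {n : ℕ} → {Γ : Fin n → S} → Formula L Γ → ℕ
  | _, _, .falsum => Nat.pair 0 0
  | _, _, .eq t₁ t₂ => Nat.pair 1 (Nat.pair (N.termCode t₁) (N.termCode t₂))
  | _, _, .rel R ts =>
      Nat.pair 2 (Nat.pair (N.rel ⟨_, _, R⟩)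
        (Encodable.encode (List.ofFn fun i => N.termCode (ts i))))
  | _, _, .imp φ₁ φ₂ => Nat.pair 3 (Nat.pair (code φ₁) (code φ₂))
  | _, _, .all τ φ => Nat.pair 4 (Nat.pair (N.sort τ) (code φ))

/-- The code of a formula together with its list of variables. -/
def codeInCtx {n : ℕ} {Γ : Fin n → S} (φ : Formula L Γ) : ℕ :=
  Nat.pair (N.ctxCode Γ) (N.code φ)

/-- On Gödel numbers, `g` carries out a uniform elimination of the quantifiers over `σ` for the
family `s`. -/
def EliminatesVia {ι : Type x} {M : ι → S → Type w} (σ : S) (s : ∀ i, Struc L (M i))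
    (g : ℕ → ℕ) : Prop :=
  ∀ (n : ℕ) (Γ : Fin n → S) (φ : Formula L Γ), ∃ φ' : Formula L Γ,
    g (N.codeInCtx φ) = N.code φ' ∧
    φ'.QuantFreeIn σ ∧ ∀ (i : ι) (a : ∀ j, M i (Γ j)), φ'.Realize (s i) a ↔ φ.Realize (s i) a

end Numbering

/-! ### Boolean values and restricted products -/

section Products

variable {L : Lang.{u, v} S} {ι : Type x} {M : ι → S → Type w}

/-- The Boolean value `[[φ(a)]] = {i | M i ⊨ φ(a(i))}`. -/
def boolVal (s : ∀ i, Struc L (M i)) {n : ℕ} {Γ : Fin n → S} (φ : Formula L Γ)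
    (a : ∀ (j : Fin n) (i : ι), M i (Γ j)) : Set ι :=
  {i | φ.Realize (s i) fun j => a j i}

/-- Each function symbol maps the sets `D i τ` into each other, for all but finitely many `i`. -/
def AlmostClosed (s : ∀ i, Struc L (M i)) (D : ∀ (i : ι) (τ : S), Set (M i τ)) : Prop :=
  ∀ {k : ℕ} {as : Fin k → S} {τ : S} (f : L.Func as τ), ∀ᶠ i in cofinite,
    ∀ c : ∀ j, M i (as j), (∀ j, c j ∈ D i (as j)) → (s i).func f c ∈ D i τ

/-- The restricted product of the structures `M i` with respect to the sets `D i τ`: its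
sort `τ` consists of the `f ∈ ∏ i, M i τ` with `f i ∈ D i τ` for all but finitely many `i`;
function symbols act componentwise, and a relation holds if it holds in every component. -/
def restrictedProd (s : ∀ i, Struc L (M i)) (D : ∀ (i : ι) (τ : S), Set (M i τ))
    (hD : AlmostClosed s D) : Struc L fun τ => Πʳ i, [M i τ, D i τ] where
  func f a := ⟨fun i => (s i).func f fun j => a j i, by
    filter_upwards [hD f, eventually_all.2 fun j => (a j).2] with i hi ha
    exact hi _ ha⟩
  rel R a := ∀ i, (s i).rel R fun j => a j i

end Products

end ManySorted

namespace AdelicQE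

open ManySorted

/-! ### The Boolean language -/

/-- The symbols of the language of Boolean algebras and the predicate `Fin`, inside a (one-sorted)
language extending it. -/
structure BoolSymbols (𝓛 : Lang.{0, v} Unit) where
  bot : 𝓛.Func (fun _ : Fin 0 => ()) ()
  top : 𝓛.Func (fun _ : Fin 0 => ()) ()
  inf : 𝓛.Func (fun _ : Fin 2 => ()) ()
  sup : 𝓛.Func (fun _ : Fin 2 => ()) ()
  compl : 𝓛.Func (fun _ : Fin 1 => ()) ()
  fin : 𝓛.Rel (fun _ : Fin 1 => ())

/-- `P` is an enrichment of the Boolean algebra of all subsets of `I` with the predicate for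
finite subsets; the other symbols of `𝓛` are interpreted arbitrarily. -/
structure BoolSymbols.IsPowerset {𝓛 : Lang.{0, v} Unit} (b : BoolSymbols 𝓛) {I : Type w}
    (P : Struc 𝓛 fun _ => Set I) : Prop where
  bot : ∀ X, P.func b.bot X = ∅
  top : ∀ X, P.func b.top X = Set.univ
  inf : ∀ X, P.func b.inf X = X 0 ∩ X 1
  sup : ∀ X, P.func b.sup X = X 0 ∪ X 1
  compl : ∀ X, P.func b.compl X = (X 0)ᶜ
  fin : ∀ X, P.rel b.fin X ↔ (X 0).Finite

/-! ### Languages for the completions -/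

/-- The symbols of the language of rings on the sort `fld` of a many-sorted language. -/
structure RingSymbols {S : Type u} (L : Lang.{u, v} S) (fld : S) where
  zero : L.Func (fun _ : Fin 0 => fld) fld
  one : L.Func (fun _ : Fin 0 => fld) fld
  add : L.Func (fun _ : Fin 2 => fld) fld
  mul : L.Func (fun _ : Fin 2 => fld) fld

/-- The ring symbols are interpreted by the operations of the ring `F`, with which
the sort `fld` is identified through `e`. -/
structure RingSymbols.Standard {S : Type u} {L : Lang.{u, v} S} {fld : S} (r : RingSymbols L fld)
    {M : S → Type w} (s : Struc L M) {F : Type*} [Ring F] (e : M fld ≃ F) : Prop where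
  zero : ∀ c, e (s.func r.zero c) = 0
  one : ∀ c, e (s.func r.one c) = 1
  add : ∀ c, e (s.func r.add c) = e (c 0) + e (c 1)
  mul : ∀ c, e (s.func r.mul c) = e (c 0) * e (c 1)

section Adeles

variable {K : Type t} [Field K] [NumberField K] {S : Type u} {L : Lang.{u, v} S} {fld : S}
  {M : HeightOneSpectrum (𝓞 K) → S → Type w}

/-- The sets with respect to which the restricted product is taken: the valuation ring `𝓞_v` in the
field sort (which is identified with `K_v` through `e v`), and the set defined by
the formula `Φ τ` in any other sort `τ`. -/
def restrictTo (s : ∀ v, Struc L (M v)) (e : ∀ v, M v fld ≃ v.adicCompletion K)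
    (Φ : ∀ τ : S, Formula L (fun _ : Fin 1 => τ)) (v : HeightOneSpectrum (𝓞 K)) (τ : S) :
    Set (M v τ) :=
  {c | (∀ h : τ = fld, e v (h ▸ c) ∈ v.adicCompletionIntegers K) ∧
    (τ ≠ fld → (Φ τ).Realize (s v) fun _ => c)}

/-- The finite adeles of `K` as an `L`-structure: the restricted product of the `K_v`. -/
def finiteAdeles (s : ∀ v, Struc L (M v)) (e : ∀ v, M v fld ≃ v.adicCompletion K)
    (Φ : ∀ τ : S, Formula L (fun _ : Fin 1 => τ)) (h : AlmostClosed s (restrictTo s e Φ)) :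
    Struc L fun τ => Πʳ v, [M v τ, restrictTo s e Φ v τ] :=
  restrictedProd s (restrictTo s e Φ) h

/-- For all tuples `a` of finite adeles, `𝔸 ⊨ ψ(a)` if and only if
`P ⊨ θ([[ψ' 0 (a)]], …, [[ψ' (m-1) (a)]])`. -/
def IsReduction (s : ∀ v, Struc L (M v)) (e : ∀ v, M v fld ≃ v.adicCompletion K)
    (Φ : ∀ τ : S, Formula L (fun _ : Fin 1 => τ)) (h : AlmostClosed s (restrictTo s e Φ))
    {𝓛 : Lang.{0, v'} Unit} (P : Struc 𝓛 fun _ => Set (HeightOneSpectrum (𝓞 K)))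
    {n : ℕ} {Γ : Fin n → S} (ψ : Formula L Γ)
    {m : ℕ} (ψ' : Fin m → Formula L Γ) (θ : Formula 𝓛 (fun _ : Fin m => ())) : Prop :=
  ∀ a : (∀ j : Fin n, Πʳ v, [M v (Γ j), restrictTo s e Φ v (Γ j)]),
    ψ.Realize (finiteAdeles s e Φ h) a ↔
      θ.Realize P fun i => boolVal s (ψ' i) fun j v => a j v

end Adeles

end AdelicQE

/-! The proof is a Feferman–Vaught argument for restricted products. By induction on ψ one builds a
`Reduct`: formulas ψ_k over the factors and a Boolean formula θ such that ψ(a) holds in the product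
iff θ holds of the sets [[ψ_k(a)]]. An atomic formula holds iff its Boolean value is the whole index
set, and for an implication two reducts are put side by side. The substantial case is ∀x φ
(`Reduct.represents_all`). If φ has reduct (ψ_1, …, ψ_m; θ), a tuple X of sets has the form [[ψ_k(x,
a)]] for some x in the product iff each of the 2^m cells of X avoids the indices where no element at
all has that pattern of truth values, and meets in a finite set the indices where no element of the
restricting set has it. So ∀x becomes a quantifier over the X with these conditions, which are
expressed by Fin and by 2 * 2^m Boolean values over the factors. The two quantifier eliminations are
applied once, to the finished reduct.

The restricting sets have to be definable only in almost all factors, since Fin ignores finite sets.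
In the field sort a ring formula is used: at v not dividing 2, x is integral iff for some t the set
{y : 1 + t y² is a square} is closed under products, is not everything, and contains x
(`le_one_iff_exists_of_isSquare`). A uniformizer t gives exactly the valuation ring, while an x of
value > 1 in such a set would force it to be the whole field.

For effectivity, the reduct is primitive recursive on Gödel numbers, by course-of-values recursion,
given a finite table of the oracle for the Φ_τ. Codes of subformulas survive unchanged because
variables are only ever added at the end of a context, and substitution is replaced by quantifying
over fresh variables. -/

namespace ManySorted

/-! ### Weakening: semantics and Gödel numbers -/

section Weakening

variable {S : Type u} {L : Lang.{u, v} S} {n n' : ℕ} {Γ : Fin n → S} {Γ' : Fin n' → S}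

/-- Weakening of terms: new variables are added at the end of the context. -/
def Term.weaken (hn : n ≤ n') (h : ∀ i, Γ' (Fin.castLE hn i) = Γ i) :
    {τ : S} → Term L Γ τ → Term L Γ' τ
  | _, .var i => h i ▸ .var (Fin.castLE hn i)
  | _, .app f ts => .app f fun i => (ts i).weaken hn h

theorem consCtx_castLE (hn : n ≤ n') (h : ∀ i, Γ' (Fin.castLE hn i) = Γ i) (τ : S)
    (i : Fin (n + 1)) :
    consCtx τ Γ' (Fin.castLE (Nat.succ_le_succ hn) i) = consCtx τ Γ i := by
  cases i using Fin.cases with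
  | zero => rfl
  | succ i => exact h i

/-- Weakening of formulas: new variables are added at the end of the context, so that the de Bruijn
indices do not change. -/
def Formula.weaken : {n : ℕ} → {Γ : Fin n → S} → Formula L Γ → {n' : ℕ} → {Γ' : Fin n' → S} →
    (hn : n ≤ n') → (∀ i, Γ' (Fin.castLE hn i) = Γ i) → Formula L Γ'
  | _, _, .falsum, _, _, _, _ => .falsum
  | _, _, .eq t₁ t₂, _, _, hn, h => .eq (t₁.weaken hn h) (t₂.weaken hn h)
  | _, _, .rel R ts, _, _, hn, h => .rel R fun i => (ts i).weaken hn h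
  | _, _, .imp φ₁ φ₂, _, _, hn, h => .imp (φ₁.weaken hn h) (φ₂.weaken hn h)
  | _, _, .all τ φ, _, _, hn, h =>
    .all τ (φ.weaken (Nat.succ_le_succ hn) (consCtx_castLE hn h τ))

variable {M : S → Type w} (s : Struc L M)

theorem Term.eval_cast (a : ∀ i, M (Γ i)) {τ τ' : S} (h : τ = τ') (t : Term L Γ τ) :
    HEq ((h ▸ t : Term L Γ τ').eval s a) (t.eval s a) := by
  subst h; rfl

theorem Term.eval_weaken (hn : n ≤ n') (h : ∀ i, Γ' (Fin.castLE hn i) = Γ i)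
    {a : ∀ i, M (Γ i)} {a' : ∀ i, M (Γ' i)} (ha : ∀ i, HEq (a' (Fin.castLE hn i)) (a i))
    {τ : S} (t : Term L Γ τ) : (t.weaken hn h).eval s a' = t.eval s a := by
  induction t with
  | var i => exact eq_of_heq ((Term.eval_cast s a' (h i) _).trans (ha i))
  | app f ts ih => simp only [Term.weaken, Term.eval, ih]

theorem consAssign_castLE (hn : n ≤ n')
    {a : ∀ i, M (Γ i)} {a' : ∀ i, M (Γ' i)} (ha : ∀ i, HEq (a' (Fin.castLE hn i)) (a i))
    {τ : S} (c : M τ) (i : Fin (n + 1)) :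
    HEq (consAssign c a' (Fin.castLE (Nat.succ_le_succ hn) i)) (consAssign c a i) := by
  cases i using Fin.cases with
  | zero => exact HEq.rfl
  | succ i => exact ha i

/-- The sorts of corresponding variables are only propositionally equal, so agreement of assignments
is stated with `HEq`. The target context varies in the induction because a quantifier extends both
contexts. -/
theorem Formula.realize_weaken {n : ℕ} {Γ : Fin n → S} (φ : Formula L Γ) :
    ∀ {n' : ℕ} {Γ' : Fin n' → S} (hn : n ≤ n') (h : ∀ i, Γ' (Fin.castLE hn i) = Γ i)
      {a : ∀ i, M (Γ i)} {a' : ∀ i, M (Γ' i)} (_ : ∀ i, HEq (a' (Fin.castLE hn i)) (a i)),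
      (φ.weaken hn h).Realize s a' ↔ φ.Realize s a := by
  induction φ with
  | falsum => intros; rfl
  | eq t₁ t₂ =>
    intro n' Γ' hn h a a' ha
    simp only [Formula.weaken, Formula.Realize, Term.eval_weaken s hn h ha]
  | rel R ts =>
    intro n' Γ' hn h a a' ha
    simp only [Formula.weaken, Formula.Realize, Term.eval_weaken s hn h ha]
  | imp φ₁ φ₂ ih₁ ih₂ =>
    intro n' Γ' hn h a a' ha
    simp only [Formula.weaken, Formula.Realize, ih₁ hn h ha, ih₂ hn h ha]
  | all τ φ ih =>
    intro n' Γ' hn h a a' ha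
    simp only [Formula.weaken, Formula.Realize]
    exact forall_congr' fun c => ih _ _ (consAssign_castLE hn ha c)

theorem Numbering.termCode_cast (N : Numbering L) {τ τ' : S} (h : τ = τ') (t : Term L Γ τ) :
    N.termCode (h ▸ t : Term L Γ τ') = N.termCode t := by
  subst h; rfl

theorem Numbering.termCode_weaken (N : Numbering L) (hn : n ≤ n')
    (h : ∀ i, Γ' (Fin.castLE hn i) = Γ i) {τ : S} (t : Term L Γ τ) :
    N.termCode (t.weaken hn h) = N.termCode t := by
  induction t with
  | var i => simp only [Term.weaken, termCode_cast, termCode, Fin.val_castLE]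
  | app f ts ih => simp only [Term.weaken, Numbering.termCode, ih]

/-- Codes record variable numbers but not contexts, and weakening changes only the context. -/
theorem Numbering.code_weaken (N : Numbering L) {n : ℕ} {Γ : Fin n → S} (φ : Formula L Γ) :
    ∀ {n' : ℕ} {Γ' : Fin n' → S} (hn : n ≤ n') (h : ∀ i, Γ' (Fin.castLE hn i) = Γ i),
      N.code (φ.weaken hn h) = N.code φ := by
  induction φ with
  | falsum => intros; rfl
  | eq t₁ t₂ => intros; simp only [Formula.weaken, code, termCode_weaken]
  | rel R ts => intros; simp only [Formula.weaken, code, termCode_weaken]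
  | imp φ₁ φ₂ ih₁ ih₂ => intros; simp only [Formula.weaken, code, ih₁, ih₂]
  | all τ φ ih => intros; simp only [Formula.weaken, code, ih]

end Weakening

/-! ### Lists of premises and truth patterns -/

section Connectives

variable {S : Type u} {L : Lang.{u, v} S} {n : ℕ} {Γ : Fin n → S} {M : S → Type w} (s : Struc L M)

/-- The implication with the list of premises `l`. -/
def Formula.impList (l : List (Formula L Γ)) (φ : Formula L Γ) : Formula L Γ :=
  l.foldr .imp φ

theorem Formula.realize_impList (l : List (Formula L Γ)) (φ : Formula L Γ) (a : ∀ i, M (Γ i)) :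
    (Formula.impList l φ).Realize s a ↔ (∀ ψ ∈ l, ψ.Realize s a) → φ.Realize s a := by
  induction l with
  | nil => simp [impList]
  | cons ψ l ih =>
    rw [List.forall_mem_cons, and_imp, ← ih]
    rfl

/-- The code of an implication. -/
def impCode (c d : ℕ) : ℕ := Nat.pair 3 (Nat.pair c d)

theorem Numbering.code_impList (N : Numbering L) (l : List (Formula L Γ)) (φ : Formula L Γ) :
    N.code (Formula.impList l φ) = (l.map N.code).foldr impCode (N.code φ) := by
  induction l with
  | nil => rfl
  | cons ψ l ih => rw [List.map_cons, List.foldr_cons, ← ih]; rfl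

/-- The formula `φ` or its negation. -/
def Formula.signed (p : Bool) (φ : Formula L Γ) : Formula L Γ :=
  if p then φ else φ.imp .falsum

theorem Formula.realize_signed (p : Bool) (φ : Formula L Γ) (a : ∀ i, M (Γ i)) :
    (φ.signed p).Realize s a ↔ (p = true ↔ φ.Realize s a) := by
  cases p <;> simp [signed, Realize]

/-- The code of a formula or of its negation. -/
def signedCode (p : Bool) (c : ℕ) : ℕ := if p then c else impCode c (Nat.pair 0 0)

theorem Numbering.code_signed (N : Numbering L) (p : Bool) (φ : Formula L Γ) :
    N.code (φ.signed p) = signedCode p (N.code φ) := by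
  cases p <;> rfl

/-- The formula saying that the bits of `J` are not the truth values of the formulas `ψ`. -/
def Formula.notCell {m : ℕ} (ψ : Fin m → Formula L Γ) (J : ℕ) : Formula L Γ :=
  .impList (List.ofFn fun i => (ψ i).signed (J.testBit i)) .falsum

theorem Formula.realize_notCell {m : ℕ} (ψ : Fin m → Formula L Γ) (J : ℕ) (a : ∀ i, M (Γ i)) :
    (Formula.notCell ψ J).Realize s a ↔ ¬ ∀ i : Fin m, (J.testBit i = true ↔ (ψ i).Realize s a) := by
  simp only [notCell, realize_impList, List.forall_mem_ofFn_iff, realize_signed]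
  rfl

end Connectives

/-! ### Relativized universal quantification in a one-sorted language -/

section OneSorted

variable {𝓛 : Lang.{0, v'} Unit}

/-- Universal quantification over the first `m` variables. -/
def Formula.allN : (m : ℕ) → {k : ℕ} → Formula 𝓛 (fun _ : Fin (k + m) => ()) →
    Formula 𝓛 (fun _ : Fin k => ())
  | 0, _, φ => φ
  -- By eta for `Unit`, the context extended by `consCtx` is definitionally the constant one, so no
  -- cast is needed.
  | m + 1, _, φ => allN m (.all () φ)

theorem consAssign_head_tail {I : Type w} {k : ℕ} (c : Fin (k + 1) → I) :
    (consAssign (M := fun _ : Unit => I) (τ := ()) (Γ := fun _ : Fin k => ()) (c 0)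
      fun i => c i.succ) = c := by
  funext i
  cases i using Fin.cases <;> rfl

theorem Formula.realize_allN {I : Type w} (P : Struc 𝓛 fun _ => I) (m : ℕ) {k : ℕ}
    (φ : Formula 𝓛 (fun _ : Fin (k + m) => ())) (a : Fin k → I) :
    (allN m φ).Realize P a ↔
      ∀ c : Fin (k + m) → I, (∀ j : Fin k, c (j.addNat m) = a j) → φ.Realize P c := by
  induction m generalizing a with
  | zero =>
    refine ⟨fun h c hc => ?_, fun h => h a fun _ => rfl⟩
    obtain rfl : c = a := funext hc
    exact h
  | succ m ih =>
    refine (ih _ _).trans ⟨fun h c hc => ?_, fun h c hc d => h _ fun j => hc j⟩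
    have := h (fun i => c i.succ) (fun j => hc j) (c 0)
    exact cast (congrArg (φ.Realize P) (consAssign_head_tail c)) this

/-- For all values of the first `m` variables with `l`, the formula `θ` holds of them. -/
def Formula.relAll (m : ℕ) {k : ℕ} (l : List (Formula 𝓛 (fun _ : Fin (k + m) => ())))
    (θ : Formula 𝓛 (fun _ : Fin m => ())) : Formula 𝓛 (fun _ : Fin k => ()) :=
  .allN m (.impList l (θ.weaken (Nat.le_add_left m k) fun _ => rfl))

theorem Formula.realize_relAll {I : Type w} (P : Struc 𝓛 fun _ => I) (m : ℕ) {k : ℕ}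
    (l : List (Formula 𝓛 (fun _ : Fin (k + m) => ()))) (θ : Formula 𝓛 (fun _ : Fin m => ()))
    (a : Fin k → I) :
    (Formula.relAll m l θ).Realize P a ↔
      ∀ c : Fin (k + m) → I, (∀ j : Fin k, c (j.addNat m) = a j) → (∀ ψ ∈ l, ψ.Realize P c) →
        θ.Realize P fun i => c (i.castLE (Nat.le_add_left m k)) :=
  (realize_allN P m _ a).trans <| forall₂_congr fun c _ =>
    (realize_impList P l _ c).trans <| imp_congr_right fun _ =>
      realize_weaken P θ _ _ fun _ => HEq.rfl

/-- The code of a universal quantification over a one-sorted language. -/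
def allCode (sort c : ℕ) : ℕ := Nat.pair 4 (Nat.pair sort c)

theorem Numbering.code_allN (N : Numbering 𝓛) (m : ℕ) {k : ℕ}
    (φ : Formula 𝓛 (fun _ : Fin (k + m) => ())) :
    N.code (Formula.allN m φ) = (allCode (N.sort ()))^[m] (N.code φ) := by
  induction m with
  | zero => rfl
  | succ m ih => exact ih _

theorem Numbering.code_relAll (N : Numbering 𝓛) (m : ℕ) {k : ℕ}
    (l : List (Formula 𝓛 (fun _ : Fin (k + m) => ()))) (θ : Formula 𝓛 (fun _ : Fin m => ())) :
    N.code (Formula.relAll m l θ) =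
      (allCode (N.sort ()))^[m] ((l.map N.code).foldr impCode (N.code θ)) := by
  rw [Formula.relAll, code_allN, code_impList, code_weaken]

end OneSorted

end ManySorted

/-! ### Boolean formulas over the power set -/

namespace AdelicQE

open ManySorted

/-- The points that belong to exactly those `X i` for which the bit `i` of `J` is set. -/
def cellSet {I : Type w} {m : ℕ} (X : Fin m → Set I) (J : ℕ) : Set I :=
  {x | ∀ i : Fin m, J.testBit i = true ↔ x ∈ X i}

namespace BoolSymbols

variable {𝓛 : Lang.{0, v'} Unit} (b : BoolSymbols 𝓛) {N m : ℕ}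

/-- Terms in `N` Boolean variables. -/
abbrev BTerm (𝓛 : Lang.{0, v'} Unit) (N : ℕ) := Term 𝓛 (fun _ : Fin N => ()) ()

/-- Formulas in `N` Boolean variables. -/
abbrev BFormula (𝓛 : Lang.{0, v'} Unit) (N : ℕ) := Formula 𝓛 (fun _ : Fin N => ())

/-- The variable number `i`. -/
def bvar (i : ℕ) (h : i < N) : BTerm 𝓛 N := .var (⟨i, h⟩ : Fin N)

/-- The term `0`. -/
def botT : BTerm 𝓛 N := .app b.bot Fin.elim0

/-- The term `1`. -/
def topT : BTerm 𝓛 N := .app b.top Fin.elim0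

/-- The meet of two terms. -/
def infT (t₁ t₂ : BTerm 𝓛 N) : BTerm 𝓛 N := .app b.inf ![t₁, t₂]

/-- The complement of a term. -/
def complT (t : BTerm 𝓛 N) : BTerm 𝓛 N := .app b.compl ![t]

/-- The formula `Fin(t)`. -/
def finF (t : BTerm 𝓛 N) : BFormula 𝓛 N := .rel b.fin ![t]

/-- The meet of the first `m` variables or their complements, as prescribed by the bits of `J`. -/
def cell (h : m ≤ N) (J : ℕ) : BTerm 𝓛 N :=
  (List.ofFn fun i : Fin m =>
    if J.testBit i then bvar i (i.2.trans_le h) else b.complT (bvar i (i.2.trans_le h))).foldr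
    b.infT b.topT

/-- The formula `θ` in the last `m` of `k + m` variables. -/
def shift (k : ℕ) {m : ℕ} (θ : BFormula 𝓛 m) : BFormula 𝓛 (k + m) :=
  .relAll m (List.ofFn fun i : Fin m => .eq (bvar i (by omega)) (bvar (m + (k + i)) (by omega))) θ

/-- Variables are not renamed: `shift` quantifies over fresh first variables that are equated with
the last m ones. Thus θ keeps its variable numbers, hence its code. -/
theorem realize_shift {I : Type w} (P : Struc 𝓛 fun _ => I) {k m : ℕ} (θ : BFormula 𝓛 m)
    (a : Fin k → I) (c : Fin m → I) :
    (shift k θ).Realize P (Fin.append a c) ↔ θ.Realize P c := by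
  refine (Formula.realize_relAll P m _ θ _).trans ⟨fun h => ?_, fun h d hd hd' => ?_⟩
  -- The only admissible values: c for the fresh variables, followed by the given assignment moved
  -- up by m.
  · convert h (fun j => if hj : j < m then c ⟨j, hj⟩ else
      Fin.append a c ⟨j - m, by omega⟩) ?_ ?_ using 1
    · funext i
      simp
    · intro j
      simp
    · refine List.forall_mem_ofFn_iff.2 fun i => ?_
      simp only [bvar, Formula.Realize, Term.eval, i.2, dif_pos]
      rw [dif_neg (by simp), ← Fin.append_right a c i]
      exact congrArg _ (Fin.ext (by simp))
  · convert h using 1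
    funext i
    have h₁ := List.forall_mem_ofFn_iff.1 hd' i
    have h₂ := hd (Fin.natAdd k i)
    rw [Fin.append_right] at h₂
    refine Eq.trans (b := d ⟨m + (k + i), by omega⟩) h₁ (Eq.trans ?_ h₂)
    exact congrArg d (Fin.ext (by simp; omega))

/-- Conditions for a family of sets `X i` (the first `m` variables) to be the Boolean values
`[[φ i (x)]]` for some `x`, when the other variables say for which `J < 2 ^ m` the cell `J` of the
formulas `φ i` is empty, and for which it is disjoint from the set used in the restriction. -/
def cellConds (m : ℕ) : List (BFormula 𝓛 (2 ^ m + 2 ^ m + m)) :=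
  (List.ofFn fun J : Fin (2 ^ m) =>
    .eq (b.infT (b.cell (Nat.le_add_left m _) J) (bvar (m + J) (by omega))) b.botT) ++
  (List.ofFn fun J : Fin (2 ^ m) =>
    b.finF (b.infT (b.cell (Nat.le_add_left m _) J) (bvar (m + (2 ^ m + J)) (by omega))))

/-- The formula `θ` holds of all sets that satisfy `cellConds`. -/
def cellAll {m : ℕ} (θ : BFormula 𝓛 m) : BFormula 𝓛 (2 ^ m + 2 ^ m) :=
  .relAll m (cellConds b m) θ

namespace IsPowerset

variable {b} {I : Type w} {P : Struc 𝓛 fun _ => Set I} (hb : b.IsPowerset P) (a : Fin N → Set I)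

include hb

theorem eval_botT : (b.botT : BTerm 𝓛 N).eval P a = ∅ := hb.bot _

theorem eval_topT : (b.topT : BTerm 𝓛 N).eval P a = Set.univ := hb.top _

theorem eval_infT (t₁ t₂ : BTerm 𝓛 N) :
    (b.infT t₁ t₂).eval P a = t₁.eval P a ∩ t₂.eval P a := hb.inf _

theorem eval_complT (t : BTerm 𝓛 N) : (b.complT t).eval P a = (t.eval P a)ᶜ := hb.compl _

theorem realize_finF (t : BTerm 𝓛 N) : (b.finF t).Realize P a ↔ (t.eval P a).Finite := hb.fin _

theorem eval_cell (h : m ≤ N) (J : ℕ) :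
    (b.cell h J).eval P a = {x | ∀ i : Fin m, J.testBit i = true ↔ x ∈ a (i.castLE h)} := by
  have key : ∀ l : List (BTerm 𝓛 N),
      (l.foldr b.infT b.topT).eval P a = {x | ∀ t ∈ l, x ∈ t.eval P a} := by
    intro l
    induction l with
    | nil =>
      exact (hb.eval_topT a).trans
        (Set.ext fun x => iff_of_true trivial fun t ht => absurd ht List.not_mem_nil)
    | cons t l ih =>
      rw [List.foldr_cons, hb.eval_infT, ih]
      exact Set.ext fun x =>
        (List.forall_mem_cons (p := fun t' : BTerm 𝓛 N => x ∈ t'.eval P a)).symm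
  rw [cell, key]
  ext x
  refine List.forall_mem_ofFn_iff.trans (forall_congr' fun i => ?_)
  cases J.testBit i
  · simp only [Bool.false_eq_true, if_false, false_iff, hb.eval_complT]
    rfl
  · simp only [if_true, true_iff]
    rfl

/-- The bound sets X are the first m variables, so the parameters Z J and Z' J are the variables m +
J and m + 2 ^ m + J. -/
theorem realize_cellAll (θ : BFormula 𝓛 m) (Z Z' : Fin (2 ^ m) → Set I) :
    (b.cellAll θ).Realize P (Fin.append Z Z') ↔
      ∀ X : Fin m → Set I, (∀ J : Fin (2 ^ m), cellSet X J ∩ Z J = ∅) →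
        (∀ J : Fin (2 ^ m), (cellSet X J ∩ Z' J).Finite) → θ.Realize P X := by
  have key : ∀ c : Fin (2 ^ m + 2 ^ m + m) → Set I,
      (∀ j : Fin (2 ^ m + 2 ^ m), c (j.addNat m) = Fin.append Z Z' j) →
      ((∀ ψ ∈ b.cellConds m, ψ.Realize P c) ↔
        (∀ J : Fin (2 ^ m), cellSet (fun i => c (i.castLE (Nat.le_add_left m _))) J ∩ Z J = ∅) ∧
        ∀ J : Fin (2 ^ m),
          (cellSet (fun i => c (i.castLE (Nat.le_add_left m _))) J ∩ Z' J).Finite) := by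
    intro c hc
    refine List.forall_mem_append.trans (and_congr ?_ ?_)
    · refine List.forall_mem_ofFn_iff.trans (forall_congr' fun J => ?_)
      have h := hc (Fin.castAdd _ J)
      rw [Fin.append_left] at h
      refine iff_of_eq (congrArg₂ Eq ?_ (hb.eval_botT c))
      refine (hb.eval_infT c _ _).trans (congrArg₂ (· ∩ ·) (hb.eval_cell c _ _) ?_)
      rw [← h]
      exact congrArg c (Fin.ext (by simp; omega))
    · refine List.forall_mem_ofFn_iff.trans (forall_congr' fun J => (hb.realize_finF c _).trans ?_)
      have h := hc (Fin.natAdd _ J)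
      rw [Fin.append_right] at h
      refine iff_of_eq (congrArg Set.Finite ?_)
      refine (hb.eval_infT c _ _).trans (congrArg₂ (· ∩ ·) (hb.eval_cell c _ _) ?_)
      rw [← h]
      exact congrArg c (Fin.ext (by simp; omega))
  refine (Formula.realize_relAll P m _ θ _).trans ⟨fun h X h₁ h₂ => ?_, fun h c hc hc' => ?_⟩
  · have hX : (fun i : Fin m => (fun j : Fin (2 ^ m + 2 ^ m + m) => if hj : j < m then X ⟨j, hj⟩
        else Fin.append Z Z' ⟨j - m, by omega⟩) (i.castLE (Nat.le_add_left m _))) = X := by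
      funext i
      simp
    have := h (fun j => if hj : j < m then X ⟨j, hj⟩ else Fin.append Z Z' ⟨j - m, by omega⟩)
      (fun j => by simp) ((key _ fun j => by simp).2 (by rw [hX]; exact ⟨h₁, h₂⟩))
    rwa [hX] at this
  · obtain ⟨h₁, h₂⟩ := (key c hc).1 hc'
    exact h _ h₁ h₂

end IsPowerset

end BoolSymbols

/-! ### The Feferman–Vaught reduction -/

open BoolSymbols

/-- Formulas `fml i` and a formula `bool` in the corresponding Boolean variables. -/
structure Reduct {S : Type u} (L : Lang.{u, v} S) (𝓛 : Lang.{0, v'} Unit) {n : ℕ}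
    (Γ : Fin n → S) where
  m : ℕ
  fml : Fin m → Formula L Γ
  bool : BFormula 𝓛 m

section Reduction

variable {S : Type u} {L : Lang.{u, v} S} {𝓛 : Lang.{0, v'} Unit} (b : BoolSymbols 𝓛)
  (Ψ : ∀ τ : S, Formula L (fun _ : Fin 1 => τ))

/-- The reduct of a formula that holds in the product if and only if it holds everywhere. -/
def Reduct.atom {n : ℕ} {Γ : Fin n → S} (φ : Formula L Γ) : Reduct L 𝓛 Γ :=
  ⟨1, fun _ => φ, .eq (bvar 0 Nat.one_pos) b.topT⟩

/-- The reduct of an implication. -/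
def Reduct.imp {n : ℕ} {Γ : Fin n → S} (R₁ R₂ : Reduct L 𝓛 Γ) : Reduct L 𝓛 Γ where
  m := R₁.m + R₂.m
  fml := Fin.append R₁.fml R₂.fml
  bool := .imp (R₁.bool.weaken (Nat.le_add_right _ _) fun _ => rfl) (shift R₁.m R₂.bool)

/-- The formulas of the reduct of `∀ x : τ, φ`: they describe for which `J < 2 ^ m` the cell `J` of
the formulas of the reduct of `φ` is nonempty, and for which it contains an `x` with `Ψ τ`. -/
def Reduct.allFml {n : ℕ} {Γ : Fin n → S} (τ : S) (R : Reduct L 𝓛 (consCtx τ Γ)) :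
    Fin (2 ^ R.m + 2 ^ R.m) → Formula L Γ :=
  Fin.append (fun J => .all τ (.notCell R.fml J)) fun J =>
    -- Weakening keeps variable 0, so the only variable of `Ψ τ` becomes the one just bound.
    .all τ (.imp ((Ψ τ).weaken (Nat.le_add_left 1 n) fun i => by
      obtain rfl := Subsingleton.elim i 0; rfl) (.notCell R.fml J))

/-- The reduct of a universally quantified formula. -/
def Reduct.all {n : ℕ} {Γ : Fin n → S} (τ : S) (R : Reduct L 𝓛 (consCtx τ Γ)) :
    Reduct L 𝓛 Γ where
  m := 2 ^ R.m + 2 ^ R.m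
  fml := R.allFml Ψ τ
  bool := cellAll b R.bool

/-- The reduction of a formula over the restricted product to formulas over the factors and
a formula over the power set of the index set. -/
def reduct : {n : ℕ} → {Γ : Fin n → S} → Formula L Γ → Reduct L 𝓛 Γ
  | _, _, .falsum => ⟨0, Fin.elim0, .falsum⟩
  | _, _, .eq t₁ t₂ => .atom b (.eq t₁ t₂)
  | _, _, .rel R ts => .atom b (.rel R ts)
  | _, _, .imp φ₁ φ₂ => .imp (reduct φ₁) (reduct φ₂)
  | _, _, .all τ φ => .all b Ψ τ (reduct φ)

/-! ### Correctness of the reduction over a restricted product -/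

section Correctness

variable {I : Type x} {M : I → S → Type w} {s : ∀ i, Struc L (M i)}
  {D : ∀ (i : I) (τ : S), Set (M i τ)} (hD : AlmostClosed s D)
  {P : Struc 𝓛 fun _ => Set I} (hb : b.IsPowerset P)

/-- The reduct has, over the power set of the index set, the same meaning as `φ` has over
the restricted product. -/
def Reduct.Represents (P : Struc 𝓛 fun _ => Set I) {n : ℕ} {Γ : Fin n → S} (R : Reduct L 𝓛 Γ)
    (φ : Formula L Γ) : Prop :=
  ∀ a : (∀ j : Fin n, Πʳ i, [M i (Γ j), D i (Γ j)]),
    φ.Realize (restrictedProd s D hD) a ↔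
      R.bool.Realize P fun k => boolVal s (R.fml k) fun j i => a j i

theorem eval_restrictedProd {n : ℕ} {Γ : Fin n → S} {τ : S} (t : Term L Γ τ)
    (a : ∀ j : Fin n, Πʳ i, [M i (Γ j), D i (Γ j)]) (i : I) :
    (t.eval (restrictedProd s D hD) a) i = t.eval (s i) fun j => a j i := by
  induction t with
  | var j => rfl
  | app f ts ih =>
    change (s i).func f _ = (s i).func f _
    congr 1
    funext j
    exact ih j

include hb

theorem Reduct.represents_atom {n : ℕ} {Γ : Fin n → S} {φ : Formula L Γ}
    (hφ : ∀ a : (∀ j : Fin n, Πʳ i, [M i (Γ j), D i (Γ j)]),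
      φ.Realize (restrictedProd s D hD) a ↔ ∀ i, φ.Realize (s i) fun j => a j i) :
    (Reduct.atom b φ).Represents hD P φ := by
  intro a
  rw [hφ]
  change _ ↔ boolVal s φ _ = b.topT.eval P _
  rw [hb.eval_topT, Set.eq_univ_iff_forall]
  rfl

omit hb in
theorem boolVal_append {n : ℕ} {Γ : Fin n → S} {m₁ m₂ : ℕ} (φ₁ : Fin m₁ → Formula L Γ)
    (φ₂ : Fin m₂ → Formula L Γ) (a : ∀ (j : Fin n) (i : I), M i (Γ j)) :
    (fun k => boolVal s (Fin.append φ₁ φ₂ k) a) =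
      Fin.append (fun k => boolVal s (φ₁ k) a) fun k => boolVal s (φ₂ k) a := by
  funext k
  refine Fin.addCases (fun k => ?_) (fun k => ?_) k
  · rw [Fin.append_left, Fin.append_left]
  · rw [Fin.append_right, Fin.append_right]

omit hb in
theorem Reduct.represents_imp {n : ℕ} {Γ : Fin n → S} {φ₁ φ₂ : Formula L Γ}
    {R₁ R₂ : Reduct L 𝓛 Γ} (h₁ : R₁.Represents hD P φ₁) (h₂ : R₂.Represents hD P φ₂) :
    (R₁.imp R₂).Represents hD P (φ₁.imp φ₂) := by
  intro a
  change _ ↔ Formula.Realize P (Formula.imp _ _)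
    fun k : Fin (R₁.m + R₂.m) => boolVal s (Fin.append R₁.fml R₂.fml k) fun j i => a j i
  rw [boolVal_append]
  refine imp_congr ((h₁ a).trans ?_) ((h₂ a).trans ?_)
  · exact (Formula.realize_weaken P _ _ _ fun i => heq_of_eq (Fin.append_left _ _ i)).symm
  · exact (realize_shift P _ _ _).symm

/-- Each index lies in exactly one cell of X. Choosing there an element with that truth pattern,
inside `D i τ` whenever possible, gives an x whose Boolean values are X: the emptiness conditions
make the choice possible everywhere, the finiteness conditions put it in `D i τ` almost everywhere.
Conversely, every x of the product yields sets satisfying the conditions. -/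
theorem Reduct.represents_all {n : ℕ} {Γ : Fin n → S} {τ : S} {φ : Formula L (consCtx τ Γ)}
    {R : Reduct L 𝓛 (consCtx τ Γ)}
    (hΨ : ∀ᶠ i in cofinite, ∀ c : M i τ, (Ψ τ).Realize (s i) (fun _ => c) ↔ c ∈ D i τ)
    (h : R.Represents hD P φ) : (R.all b Ψ τ).Represents hD P (φ.all τ) := by
  intro a
  change _ ↔ Formula.Realize P (b.cellAll R.bool)
    fun k : Fin (2 ^ R.m + 2 ^ R.m) => boolVal s (R.allFml Ψ τ k) fun j i => a j i
  rw [Reduct.allFml, boolVal_append, hb.realize_cellAll]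
  have hcons : ∀ c : Πʳ i, [M i τ, D i τ],
      (fun (j : Fin (n + 1)) (i : I) =>
        (consAssign (M := fun τ => Πʳ i, [M i τ, D i τ]) (Γ := Γ) c a j : ∀ i, _) i) =
      fun j i => consAssign (M := M i) (Γ := Γ) (c i) (fun j => a j i) j := by
    intro c
    funext j i
    cases j using Fin.cases <;> rfl
  have hW : ∀ c : Πʳ i, [M i τ, D i τ], φ.Realize (restrictedProd s D hD)
        (consAssign (M := fun τ => Πʳ i, [M i τ, D i τ]) (Γ := Γ) c a) ↔
      R.bool.Realize P fun k => {i | (R.fml k).Realize (s i)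
        (consAssign (M := M i) (Γ := Γ) (c i) fun j => a j i)} := by
    intro c
    refine (h _).trans (iff_of_eq (congrArg (R.bool.Realize P) ?_))
    funext k
    exact congrArg (boolVal s (R.fml k)) (hcons c)
  have hZ : ∀ i (J : ℕ), i ∈ boolVal s (.all τ (.notCell R.fml J)) (fun j i => a j i) ↔
      ∀ c : M i τ, ¬ ∀ k : Fin R.m, (J.testBit k = true ↔ (R.fml k).Realize (s i)
        (consAssign (M := M i) (Γ := Γ) c fun j => a j i)) := fun i J =>
    forall_congr' fun c => Formula.realize_notCell _ _ _ _
  have hZ' : ∀ i (J : ℕ) h₁ h₂, i ∈ boolVal s (.all τ (.imp ((Ψ τ).weaken h₁ h₂)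
        (.notCell R.fml J))) (fun j i => a j i) ↔
      ∀ c : M i τ, (Ψ τ).Realize (s i) (fun _ => c) →
        ¬ ∀ k : Fin R.m, (J.testBit k = true ↔ (R.fml k).Realize (s i)
          (consAssign (M := M i) (Γ := Γ) c fun j => a j i)) := fun i J h₁ h₂ =>
    forall_congr' fun c => imp_congr
      (Formula.realize_weaken (s i) (Ψ τ) _ _ fun k => by
        obtain rfl := Subsingleton.elim k 0; exact HEq.rfl)
      (Formula.realize_notCell _ _ _ _)
  constructor
  · intro H X h₁ h₂
    have hJ : ∀ i, ∃ J : Fin (2 ^ R.m), i ∈ cellSet X J := by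
      classical
      intro i
      -- The cell of i is the number whose bits record which X k contain i.
      refine ⟨⟨Nat.ofBits fun k : Fin R.m => decide (i ∈ X k), Nat.ofBits_lt_two_pow _⟩, fun k => ?_⟩
      simp [Nat.testBit_ofBits_lt]
    choose J hJ using hJ
    -- The second clause makes the choice prefer elements of `D i τ`; this is what puts c in the
    -- restricted product.
    have hex : ∀ i, ∃ c : M i τ, (∀ k : Fin R.m, (J i : ℕ).testBit k = true ↔
        (R.fml k).Realize (s i) (consAssign (M := M i) (Γ := Γ) c fun j => a j i)) ∧
        ((∃ c' ∈ D i τ, ∀ k : Fin R.m, (J i : ℕ).testBit k = true ↔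
          (R.fml k).Realize (s i) (consAssign (M := M i) (Γ := Γ) c' fun j => a j i)) →
          c ∈ D i τ) := by
      intro i
      by_cases hc : ∃ c' ∈ D i τ, ∀ k : Fin R.m, (J i : ℕ).testBit k = true ↔
          (R.fml k).Realize (s i) (consAssign (M := M i) (Γ := Γ) c' fun j => a j i)
      · obtain ⟨c', hc', h'⟩ := hc
        exact ⟨c', h', fun _ => hc'⟩
      -- No element of `D i τ` fits, but the emptiness condition for the cell of i still provides
      -- some element.
      · have := fun hi => (Set.eq_empty_iff_forall_notMem.1 (h₁ (J i)) i) ⟨hJ i, hi⟩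
        rw [hZ] at this
        obtain ⟨c, hc'⟩ := not_forall.1 this
        rw [not_not] at hc'
        exact ⟨c, hc', fun h => absurd h hc⟩
    choose c hc hcD using hex
    -- The exceptions are the i where `Ψ τ` fails to define `D i τ`, and the finite sets of `h₂` for
    -- the finitely many cells.
    have hfin : ∀ᶠ i in cofinite, c i ∈ D i τ := by
      filter_upwards [hΨ, eventually_all.2 fun K => (h₂ K).eventually_cofinite_notMem] with i hi hi'
      by_contra hci
      refine hi' (J i) ⟨hJ i, (hZ' _ _ _ _).2 fun c' hc' hk => hci (hcD i ⟨c', (hi c').1 hc', hk⟩)⟩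
    convert (hW ⟨c, hfin⟩).1 (H ⟨c, hfin⟩) using 1
    funext k
    ext i
    exact (hJ i k).symm.trans (hc i k)
  · intro H c
    refine (hW c).2 (H _ (fun K => ?_) fun K => ?_)
    · rw [Set.eq_empty_iff_forall_notMem]
      rintro i ⟨hi, hi'⟩
      exact (hZ _ _).1 hi' (c i) hi
    -- Where `Ψ τ` defines `D i τ` and c i lies in it, c i itself realizes its cell.
    · refine (eventually_cofinite.1 (hΨ.and c.2)).subset ?_
      rintro i ⟨hi, hi'⟩ ⟨h₃, h₄⟩
      exact (hZ' _ _ _ _).1 hi' (c i) ((h₃ _).2 h₄) hi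

/-- A formula over the restricted product is represented by its reduct, if the sets used in
the restriction are defined by `Ψ` in almost all factors. -/
theorem represents_reduct
    (hΨ : ∀ τ, ∀ᶠ i in cofinite, ∀ c : M i τ, (Ψ τ).Realize (s i) (fun _ => c) ↔ c ∈ D i τ)
    {n : ℕ} {Γ : Fin n → S} (φ : Formula L Γ) : (reduct b Ψ φ).Represents hD P φ := by
  induction φ with
  | falsum => exact fun a => Iff.rfl
  | eq t₁ t₂ =>
    refine Reduct.represents_atom b hD hb fun a => ?_
    refine RestrictedProduct.ext_iff.trans (forall_congr' fun i => ?_)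
    exact iff_of_eq (congrArg₂ Eq (eval_restrictedProd hD t₁ a i) (eval_restrictedProd hD t₂ a i))
  | rel R ts =>
    refine Reduct.represents_atom b hD hb fun a => forall_congr' fun i => ?_
    refine iff_of_eq (congrArg ((s i).rel R) (funext fun j => ?_))
    exact eval_restrictedProd hD (ts j) a i
  | imp φ₁ φ₂ ih₁ ih₂ => exact Reduct.represents_imp hD ih₁ ih₂
  | all τ φ ih => exact Reduct.represents_all b Ψ hD hb (hΨ τ) ih

end Correctness

end Reduction

/-! ### Squares and the definition of the valuation ring -/

section Valuation

/-- In a complete nonarchimedean field of residue characteristic not `2`, the elements `1 + u` with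
`‖u‖ < 1` are squares. -/
theorem isSquare_one_add {F : Type*} [NormedField F] [CompleteSpace F] [IsUltrametricDist F]
    (h2 : ‖(2 : F)‖ = 1) {u : F} (hu : ‖u‖ < 1) : ∃ y : F, y * y = 1 + u := by
  have h20 : (2 : F) ≠ 0 := by
    rintro h
    rw [h, norm_zero] at h2
    exact zero_ne_one h2
  -- Newton's iteration for y² = 1 + u with the derivative frozen at its value 2 in y = 1. On the
  -- closed ball of radius ‖u‖ about 1 it is a contraction with factor ‖u‖.
  let T : F → F := fun y => y - (y * y - (1 + u)) / 2
  have hT1 : ∀ y, T y - 1 = (u - (y - 1) * (y - 1)) / 2 := fun y => by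
    simp only [T]; field_simp; ring
  have hT2 : ∀ y z, T y - T z = (y - z) * ((z - 1) + (y - 1)) / -2 := fun y z => by
    simp only [T]; field_simp; ring
  have hmaps : Set.MapsTo T (Metric.closedBall 1 ‖u‖) (Metric.closedBall 1 ‖u‖) := by
    intro y hy
    rw [mem_closedBall_iff_norm] at hy ⊢
    rw [hT1, norm_div, h2, div_one]
    rw [sub_eq_add_neg]
    refine (IsUltrametricDist.norm_add_le_max _ _).trans (max_le le_rfl ?_)
    rw [norm_neg, norm_mul]
    exact (mul_le_of_le_one_right (norm_nonneg _) (hy.trans hu.le)).trans hy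
  have hcontr : ContractingWith ‖u‖₊ (hmaps.restrict T _ _) := by
    refine ⟨hu, LipschitzWith.of_dist_le_mul ?_⟩
    rintro ⟨y, hy⟩ ⟨z, hz⟩
    rw [mem_closedBall_iff_norm] at hy hz
    change dist (T y) (T z) ≤ ‖u‖ * dist y z
    rw [dist_eq_norm, dist_eq_norm, hT2, norm_div, norm_neg, h2, div_one, norm_mul, mul_comm]
    exact mul_le_mul_of_nonneg_right
      ((IsUltrametricDist.norm_add_le_max _ _).trans (max_le hz hy)) (norm_nonneg _)
  obtain ⟨y, -, hy, -⟩ := hcontr.exists_fixedPoint' Metric.isClosed_closedBall.isComplete hmaps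
    (Metric.mem_closedBall_self (norm_nonneg u)) (edist_ne_top _ _)
  refine ⟨y, ?_⟩
  have : (y * y - (1 + u)) / 2 = 0 := by
    have h : y - (y * y - (1 + u)) / 2 = y := hy
    exact sub_eq_self.1 h
  rw [div_eq_zero_iff, or_iff_left h20] at this
  exact sub_eq_zero.1 this

open WithZero in
/-- A ring-theoretic description of the valuation ring of a discrete valuation for which
all `1 + u` with `u` in the maximal ideal are squares. -/
theorem le_one_iff_exists_of_isSquare {F : Type*} [Field F] (ν : Valuation F ℤᵐ⁰)
    (hν : Function.Surjective ν) (hsq : ∀ u, ν u < 1 → ∃ y : F, y * y = 1 + u) (x : F) :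
    ν x ≤ 1 ↔ ∃ t, (∀ x y, (∃ z, z * z = 1 + t * (x * x)) → (∃ z, z * z = 1 + t * (y * y)) →
        ∃ z, z * z = 1 + t * ((x * y) * (x * y))) ∧
      (∃ x, ¬ ∃ z, z * z = 1 + t * (x * x)) ∧ ∃ z, z * z = 1 + t * (x * x) := by
  constructor
  · intro hx
    obtain ⟨t, ht⟩ := hν (exp (-1))
    -- For the uniformizer t: if ν y > 1, then t y² dominates 1 and has odd exponent, so 1 + t y² is
    -- not a square. If ν y ≤ 1, then t y² lies in the maximal ideal and `hsq` applies.
    have key : ∀ y, (∃ z, z * z = 1 + t * (y * y)) ↔ ν y ≤ 1 := by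
      intro y
      constructor
      · rintro ⟨z, hz⟩
        by_contra! hy
        have hy0 : ν y ≠ 0 := (zero_lt_one.trans hy).ne'
        obtain ⟨n, hn⟩ : ∃ n : ℤ, ν y = exp n := ⟨_, (exp_log hy0).symm⟩
        rw [hn, ← exp_zero, exp_lt_exp] at hy
        have h1 : ν (t * (y * y)) = exp (-1 + (n + n)) := by
          rw [map_mul, map_mul, ht, hn, exp_add, exp_add]
        have h2 : ν (1 + t * (y * y)) = exp (-1 + (n + n)) := by
          rw [Valuation.map_add_eq_of_lt_right, h1]
          rw [h1, map_one, ← exp_zero, exp_lt_exp]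
          omega
        rw [← hz, map_mul] at h2
        have hz0 : ν z ≠ 0 := by
          intro h
          rw [h, zero_mul] at h2
          exact exp_ne_zero h2.symm
        obtain ⟨k, hk⟩ : ∃ k : ℤ, ν z = exp k := ⟨_, (exp_log hz0).symm⟩
        rw [hk, ← exp_add, exp_inj] at h2
        omega
      · intro hy
        refine hsq _ ?_
        rw [map_mul, map_mul, ht]
        refine lt_of_le_of_lt (mul_le_of_le_one_right' (mul_le_one' hy hy)) ?_
        rw [← exp_zero, exp_lt_exp]
        omega
    refine ⟨t, fun a b ha hb => ?_, ?_, (key x).2 hx⟩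
    · rw [key] at ha hb ⊢
      rw [map_mul]
      exact mul_le_one' ha hb
    · obtain ⟨z, hz⟩ := hν (exp 1)
      refine ⟨z, ?_⟩
      rw [key, hz, ← exp_zero, exp_le_exp]
      omega
  · rintro ⟨t, hmul, ⟨z, hz⟩, hx⟩
    by_contra! hx1
    have hx0 : x ≠ 0 := by
      rintro rfl
      rw [map_zero] at hx1
      exact not_lt_zero hx1
    -- As ν x > 1, dividing z by a high power of x makes t (z / x ^ (n + 1))² small, so this
    -- quotient lies in the set of y with 1 + t y² a square.
    obtain ⟨n, hn⟩ := MulArchimedean.arch (ν (t * (z * z))) hx1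
    have hw : ∃ w, w * w = 1 + t * ((z / x ^ (n + 1)) * (z / x ^ (n + 1))) := by
      refine hsq _ ?_
      have hpos : (0 : ℤᵐ⁰) < ν x ^ (n + 1) := pow_pos (zero_lt_one.trans hx1) _
      have : t * ((z / x ^ (n + 1)) * (z / x ^ (n + 1))) =
          t * (z * z) / (x ^ (n + 1) * x ^ (n + 1)) := by
        field_simp
      rw [this, map_div₀, map_mul ν (x ^ _), map_pow, div_lt_one₀ (mul_pos hpos hpos)]
      calc ν (t * (z * z)) ≤ ν x ^ n := hn
        _ < ν x ^ (n + 1) := pow_lt_pow_right₀ hx1 n.lt_succ_self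
        _ ≤ _ := le_mul_of_one_le_right' (one_le_pow₀ hx1.le)
    -- Closure under multiplication by x leads back to z, which was chosen outside the set.
    have hind : ∀ k : ℕ, ∃ w, w * w =
        1 + t * ((z / x ^ (n + 1) * x ^ k) * (z / x ^ (n + 1) * x ^ k)) := by
      intro k
      induction k with
      | zero => simpa using hw
      | succ k ih =>
        rw [pow_succ x k, ← mul_assoc (z / _)]
        exact hmul _ _ ih hx
    have := hind (n + 1)
    rw [div_mul_cancel₀ _ (pow_ne_zero _ hx0)] at this
    exact hz this

end Valuation

/-! ### The completions at places not dividing 2 -/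

section Completion

variable {K : Type t} [Field K] [NumberField K]

/-- The norm and the valuation have the same open unit ball, and 2 has norm 1 because it is not in
the prime of v. -/
theorem isSquare_one_add_adicCompletion (v : HeightOneSpectrum (𝓞 K)) (h2 : (2 : 𝓞 K) ∉ v.asIdeal)
    (u : v.adicCompletion K) (hu : Valued.v u < 1) : ∃ y, y * y = 1 + u := by
  have hnorm : ∀ x : v.adicCompletion K, ‖x‖ < 1 ↔ Valued.v x < 1 := fun x =>
    Valued.toNormedField.norm_lt_one_iff
  have : IsUltrametricDist (v.adicCompletion K) :=
    IsUltrametricDist.isUltrametricDist_of_isNonarchimedean_norm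
      (Valued.isNonarchimedean_norm _ _)
  refine isSquare_one_add ?_ ((hnorm u).2 hu)
  have := (NumberField.FinitePlace.norm_eq_one_iff_notMem K v 2).2 h2
  rwa [map_ofNat, map_ofNat] at this

theorem finite_two_mem (K : Type t) [Field K] [NumberField K] :
    {v : HeightOneSpectrum (𝓞 K) | (2 : 𝓞 K) ∈ v.asIdeal}.Finite := by
  refine (Ideal.finite_factors (I := Ideal.span {(2 : 𝓞 K)}) ?_).subset fun v hv => ?_
  · simp
  · exact Ideal.dvd_span_singleton.2 hv

end Completion

/-! ### The ring formula for the valuation ring -/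

section Formula

variable {S : Type u} {L : Lang.{u, v} S} {fld : S}

/-- Formulas in `n` variables of sort `fld`. -/
abbrev FFormula (L : Lang.{u, v} S) (fld : S) (n : ℕ) := Formula L (fun _ : Fin n => fld)

/-- Universal quantification over the sort `fld`. -/
def allF {n : ℕ} (φ : FFormula L fld (n + 1)) : FFormula L fld n :=
  -- The constant context and the extended one agree only after a case distinction on the index;
  -- weakening by no variables acts as the cast.
  .all fld (φ.weaken le_rfl fun i => by cases i using Fin.cases <;> rfl)

/-- Negation. -/
def notF {n : ℕ} (φ : FFormula L fld n) : FFormula L fld n := φ.imp .falsum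

/-- Conjunction. -/
def andF {n : ℕ} (φ ψ : FFormula L fld n) : FFormula L fld n := notF (φ.imp (notF ψ))

/-- Existential quantification over the sort `fld`. -/
def exF {n : ℕ} (φ : FFormula L fld (n + 1)) : FFormula L fld n := notF (allF (notF φ))

/-- The variable number `i`, of sort `fld`. -/
def varF {n : ℕ} (i : Fin n) : Term L (fun _ : Fin n => fld) fld :=
  .var (Γ := fun _ : Fin n => fld) i

/-- The product of two variables. -/
def mulVar (r : RingSymbols L fld) {n : ℕ} (i j : Fin n) : Term L (fun _ : Fin n => fld) fld :=
  .app r.mul ![varF i, varF j]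

/-- `1 + t * (x * x)` is a square, where `t` and `x` are the variables `i` and `j`. -/
def squareF (r : RingSymbols L fld) {n : ℕ} (i j : Fin n) : FFormula L fld n :=
  exF (.eq (mulVar r 0 0)
    (.app r.add ![.app r.one Fin.elim0, .app r.mul ![varF i.succ, mulVar r j.succ j.succ]]))

/-- A formula in the language of rings that defines the valuation ring of `K_v`, for all `v` that
do not divide `2`. -/
def integerF (r : RingSymbols L fld) : FFormula L fld 1 :=
  exF (andF
    -- Here 3 is t, 2 and 1 are the factors, and 0 names their product, because `squareF` takes
    -- variables only.
    (allF (allF (allF ((Formula.eq (varF 0) (mulVar r 2 1)).imp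
      ((squareF r 3 2).imp ((squareF r 3 1).imp (squareF r 3 0)))))))
    (andF (exF (notF (squareF r 1 0))) (squareF r 0 1)))

variable {M : S → Type w} (s : Struc L M)

theorem realize_allF {n : ℕ} (φ : FFormula L fld (n + 1)) (a : Fin n → M fld) :
    (allF φ).Realize s a ↔ ∀ c : M fld, φ.Realize s (Fin.cons c a : Fin (n + 1) → M fld) := by
  refine forall_congr' fun c => Formula.realize_weaken s φ _ _ fun i => ?_
  cases i using Fin.cases <;> exact HEq.rfl

theorem realize_notF {n : ℕ} (φ : FFormula L fld n) (a : Fin n → M fld) :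
    (notF φ).Realize s a ↔ ¬ φ.Realize s a := Iff.rfl

theorem realize_andF {n : ℕ} (φ ψ : FFormula L fld n) (a : Fin n → M fld) :
    (andF φ ψ).Realize s a ↔ φ.Realize s a ∧ ψ.Realize s a := by
  change ¬ (φ.Realize s a → ¬ ψ.Realize s a) ↔ _
  tauto

theorem realize_exF {n : ℕ} (φ : FFormula L fld (n + 1)) (a : Fin n → M fld) :
    (exF φ).Realize s a ↔ ∃ c : M fld, φ.Realize s (Fin.cons c a : Fin (n + 1) → M fld) := by
  rw [exF, realize_notF, realize_allF]
  simp only [realize_notF, not_forall, not_not]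

variable {s} {r : RingSymbols L fld} {F : Type*} [Ring F] {e : M fld ≃ F} (hr : r.Standard s e)

include hr

theorem eval_mulVar {n : ℕ} (i j : Fin n) (a : Fin n → M fld) :
    e ((mulVar r i j).eval s a) = e (a i) * e (a j) := hr.mul _

theorem realize_squareF {n : ℕ} (i j : Fin n) (a : Fin n → M fld) :
    (squareF r i j).Realize s a ↔ ∃ z, z * z = 1 + e (a i) * (e (a j) * e (a j)) := by
  rw [squareF, realize_exF]
  refine e.exists_congr fun {c} => e.injective.eq_iff.symm.trans (iff_of_eq (congrArg₂ Eq ?_ ?_))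
  · exact eval_mulVar hr _ _ _
  · refine (hr.add _).trans (congrArg₂ _ (hr.one _) ((hr.mul _).trans (congrArg _ ?_)))
    exact eval_mulVar hr _ _ _

theorem realize_integerF (a : Fin 1 → M fld) :
    (integerF r).Realize s a ↔
      ∃ t, (∀ x y, (∃ z, z * z = 1 + t * (x * x)) → (∃ z, z * z = 1 + t * (y * y)) →
          ∃ z, z * z = 1 + t * ((x * y) * (x * y))) ∧
        (∃ x, ¬ ∃ z, z * z = 1 + t * (x * x)) ∧ ∃ z, z * z = 1 + t * (e (a 0) * e (a 0)) := by
  rw [integerF, realize_exF]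
  refine e.exists_congr fun {t} => ?_
  rw [realize_andF, realize_andF, realize_exF]
  refine and_congr ?_ (and_congr ?_ ?_)
  · rw [realize_allF]
    refine e.forall_congr fun {x} => ?_
    rw [realize_allF]
    refine e.forall_congr fun {y} => ?_
    rw [realize_allF]
    simp only [Formula.Realize, realize_squareF hr]
    have key : ∀ z : M fld,
        ((varF 0).eval s (Fin.cons z (Fin.cons y (Fin.cons x (Fin.cons t a : Fin 2 → M fld) :
          Fin 3 → M fld) : Fin 4 → M fld) : Fin 5 → M fld) = (mulVar r 2 1).eval s
          (Fin.cons z (Fin.cons y (Fin.cons x (Fin.cons t a : Fin 2 → M fld) :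
          Fin 3 → M fld) : Fin 4 → M fld) : Fin 5 → M fld)) ↔ e z = e x * e y := fun z =>
      e.injective.eq_iff.symm.trans (iff_of_eq (congrArg₂ Eq rfl (eval_mulVar hr _ _ _)))
    simp only [key]
    constructor
    · intro h h₁ h₂
      have := h (e.symm (e x * e y)) (e.apply_symm_apply _) h₁ h₂
      rw [← e.apply_symm_apply (e x * e y)]
      exact this
    · intro h z hz h₁ h₂
      have := h h₁ h₂
      rw [← hz] at this
      exact this
  · exact e.exists_congr fun {x} => not_congr (realize_squareF hr _ _ _)
  · exact realize_squareF hr _ _ _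

end Formula

/-! ### Definability of the restricting sets -/

section Restriction

variable {K : Type t} [Field K] [NumberField K] {S : Type u} {L : Lang.{u, v} S} {fld : S}
  (r : RingSymbols L fld) {M : HeightOneSpectrum (𝓞 K) → S → Type w} {s : ∀ v, Struc L (M v)}
  {e : ∀ v, M v fld ≃ v.adicCompletion K}
  (Φ : ∀ τ : S, Formula L (fun _ : Fin 1 => τ))

open Classical in
/-- Formulas that define, for almost all `v`, the sets used in the restriction. -/
noncomputable def restrictF (τ : S) : Formula L (fun _ : Fin 1 => τ) :=
  if h : τ = fld then h ▸ integerF r else Φ τ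

/-- In the field sort the exceptions lie among the finitely many v dividing 2; in the other sorts
there are none. -/
theorem realize_restrictF (hr : ∀ v, r.Standard (s v) (e v)) (τ : S) :
    ∀ᶠ v in cofinite, ∀ c : M v τ,
      (restrictF r Φ τ).Realize (s v) (fun _ => c) ↔ c ∈ restrictTo s e Φ v τ := by
  by_cases h : τ = fld
  · subst h
    filter_upwards [(finite_two_mem K).eventually_cofinite_notMem] with v hv c
    have h₁ : c ∈ restrictTo s e Φ v τ ↔ Valued.v (e v c) ≤ 1 :=
      ⟨fun h => h.1 rfl, fun h => ⟨fun _ => h, fun h => absurd rfl h⟩⟩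
    rw [h₁, restrictF, dif_pos rfl, realize_integerF (hr v)]
    exact (le_one_iff_exists_of_isSquare Valued.v (v.valuedAdicCompletion_surjective K)
      (isSquare_one_add_adicCompletion v hv) _).symm
  · refine Eventually.of_forall fun v c => ?_
    rw [restrictF, dif_neg h]
    exact ⟨fun h' => ⟨fun h'' => absurd h'' h, fun _ => h'⟩, fun h' => h'.2 h⟩

end Restriction

open Encodable

/-! ### The reduction on Gödel numbers -/

section Codes

/-- The code of a term or of a relation with head symbol `f` and arguments `l`, where `k` is the tag
of the constructor. -/
def appCode (k f : ℕ) (l : List ℕ) : ℕ := Nat.pair k (Nat.pair f (encode l))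

/-- The code of a variable. -/
def varCode (i : ℕ) : ℕ := Nat.pair 0 i

/-- The code of an equation. -/
def eqCode (s t : ℕ) : ℕ := Nat.pair 1 (Nat.pair s t)

/-- The codes of the sort and of the symbols of the Boolean language. -/
structure BoolCodes where
  sort : ℕ
  bot : ℕ
  top : ℕ
  inf : ℕ
  compl : ℕ
  fin : ℕ

/-- The codes given by a numbering. -/
def BoolSymbols.codes {𝓛 : Lang.{0, v'} Unit} (b : BoolSymbols 𝓛) (N : Numbering 𝓛) :
    BoolCodes where
  sort := N.sort ()
  bot := N.func ⟨_, _, _, b.bot⟩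
  top := N.func ⟨_, _, _, b.top⟩
  inf := N.func ⟨_, _, _, b.inf⟩
  compl := N.func ⟨_, _, _, b.compl⟩
  fin := N.rel ⟨_, _, b.fin⟩

namespace BoolCodes

variable (B : BoolCodes)

/-- The code of the term `cell`. -/
def cellCode (m J : ℕ) : ℕ :=
  ((List.range m).map fun i =>
    bif J.testBit i then varCode i else appCode 1 B.compl [varCode i]).foldr
    (fun s t => appCode 1 B.inf [s, t]) (appCode 1 B.top [])

/-- The codes of the formulas `cellConds`. -/
def cellCondsCode (m : ℕ) : List ℕ :=
  ((List.range (2 ^ m)).map fun J =>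
    eqCode (appCode 1 B.inf [B.cellCode m J, varCode (m + J)]) (appCode 1 B.bot [])) ++
  (List.range (2 ^ m)).map fun J =>
    appCode 2 B.fin [appCode 1 B.inf [B.cellCode m J, varCode (m + (2 ^ m + J))]]

/-- The code of the formula `relAll`. -/
def relAllCode (m : ℕ) (l : List ℕ) (c : ℕ) : ℕ := (allCode B.sort)^[m] (l.foldr impCode c)

/-- The code of the formula `shift`. -/
def shiftCode (k m c : ℕ) : ℕ :=
  B.relAllCode m ((List.range m).map fun i => eqCode (varCode i) (varCode (m + (k + i)))) c

end BoolCodes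

/-- The code of the formula `notCell`. -/
def notCellCode (l : List ℕ) (J : ℕ) : ℕ :=
  ((List.range l.length).map fun i => signedCode (J.testBit i) (l.getD i 0)).foldr impCode
    (Nat.pair 0 0)

/-- The codes of the formulas `allFml`. -/
def allFmlCode (τ c : ℕ) (l : List ℕ) : List ℕ :=
  ((List.range (2 ^ l.length)).map fun J => allCode τ (notCellCode l J)) ++
  (List.range (2 ^ l.length)).map fun J => allCode τ (impCode c (notCellCode l J))

/-- The code of the reduct of a formula, computed from the list `prev` of the codes of the reducts
of the formulas with smaller Gödel numbers. The list `T` contains the codes of the formulas used in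
the restriction, for all sorts but the one with code `p.1`; for that sort the code is `p.2`. -/
def reductStep (B : BoolCodes) (p : ℕ × ℕ) (T : List ℕ) (prev : List (List ℕ × ℕ)) :
    List ℕ × ℕ :=
  -- Since `prev` lists the reducts of 0, …, n - 1, its length is the Gödel number being treated; k
  -- is its constructor tag, and i codes the first subformula or the quantified sort.
  let n := prev.length
  let k := n.unpair.1
  let i := n.unpair.2.unpair.1
  let R₁ := prev.getD i ([], 0)
  let R₂ := prev.getD n.unpair.2.unpair.2 ([], 0)
  if k = 0 then ([], Nat.pair 0 0)
  else if k = 3 then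
    (R₁.1 ++ R₂.1, impCode R₁.2 (B.shiftCode R₁.1.length R₂.1.length R₂.2))
  else if k = 4 then
    (allFmlCode i (if i = p.1 then p.2 else T.getD i 0) R₂.1,
      B.relAllCode R₂.1.length (B.cellCondsCode R₂.1.length) R₂.2)
  -- Tags 1 and 2: an atomic formula is its own single component. Numbers that code no formula get
  -- irrelevant values.
  else ([n], eqCode (varCode 0) (appCode 1 B.top []))

/-- The codes of the reducts of all formulas with Gödel numbers less than `n`. -/
def reductCodes (B : BoolCodes) (p : ℕ × ℕ) (T : List ℕ) : ℕ → List (List ℕ × ℕ)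
  | 0 => []
  | n + 1 => reductCodes B p T n ++ [reductStep B p T (reductCodes B p T n)]

/-- The code of the reduct of the formula with Gödel number `n`. -/
def reductCode (B : BoolCodes) (p : ℕ × ℕ) (T : List ℕ) (n : ℕ) : List ℕ × ℕ :=
  reductStep B p T (reductCodes B p T n)

end Codes

/-! ### Primitive recursiveness of the reduction -/

section Primrec

variable {α : Type*} [Primcodable α]

theorem primrec_natPair {f g : α → ℕ} (hf : Primrec f) (hg : Primrec g) :
    Primrec fun a => Nat.pair (f a) (g a) := Primrec₂.natPair.comp hf hg

theorem primrec_pow {f g : α → ℕ} (hf : Primrec f) (hg : Primrec g) :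
    Primrec fun a => f a ^ g a :=
  (Primrec₂.unpaired'.1 Nat.Primrec.pow).comp hf hg

theorem primrec_testBit {f g : α → ℕ} (hf : Primrec f) (hg : Primrec g) :
    Primrec fun a => (f a).testBit (g a) := by
  have : Primrec fun a => decide (f a / 2 ^ g a % 2 = 1) :=
    (Primrec.eq.comp (Primrec.nat_mod.comp (Primrec.nat_div.comp hf (primrec_pow (.const 2) hg))
      (.const 2)) (.const 1)).decide
  exact this.of_eq fun a => (Nat.testBit_eq_decide_div_mod_eq).symm

theorem primrec_map_range {β : Type*} [Primcodable β] {n : α → ℕ} {f : α → ℕ → β}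
    (hn : Primrec n) (hf : Primrec fun p : α × ℕ => f p.1 p.2) :
    Primrec fun a => (List.range (n a)).map (f a) :=
  Primrec.list_map (Primrec.list_range.comp hn) hf

theorem primrec_appCode {k f : ℕ} {l : α → List ℕ} (hl : Primrec l) :
    Primrec fun a => appCode k f (l a) :=
  primrec_natPair (.const _) (primrec_natPair (.const _) (Primrec.encode.comp hl))

theorem primrec_varCode {f : α → ℕ} (hf : Primrec f) : Primrec fun a => varCode (f a) :=
  primrec_natPair (.const _) hf

theorem primrec_eqCode {f g : α → ℕ} (hf : Primrec f) (hg : Primrec g) :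
    Primrec fun a => eqCode (f a) (g a) := primrec_natPair (.const _) (primrec_natPair hf hg)

theorem primrec_impCode {f g : α → ℕ} (hf : Primrec f) (hg : Primrec g) :
    Primrec fun a => impCode (f a) (g a) := primrec_natPair (.const _) (primrec_natPair hf hg)

theorem primrec_allCode {f g : α → ℕ} (hf : Primrec f) (hg : Primrec g) :
    Primrec fun a => allCode (f a) (g a) := primrec_natPair (.const _) (primrec_natPair hf hg)

theorem primrec_singleton {β : Type*} [Primcodable β] {f : α → β} (hf : Primrec f) :
    Primrec fun a => [f a] := Primrec.list_cons.comp hf (.const [])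

theorem primrec_signedCode {p : α → Bool} {f : α → ℕ} (hp : Primrec p) (hf : Primrec f) :
    Primrec fun a => signedCode (p a) (f a) :=
  (Primrec.cond hp hf (primrec_impCode hf (.const (Nat.pair 0 0)))).of_eq fun a => by
    cases h : p a <;> simp [signedCode]

theorem primrec_foldr_impCode {l : α → List ℕ} {f : α → ℕ} (hl : Primrec l) (hf : Primrec f) :
    Primrec fun a => (l a).foldr impCode (f a) :=
  Primrec.list_foldr hl hf
    (primrec_impCode (Primrec.fst.comp Primrec.snd) (Primrec.snd.comp Primrec.snd)).to₂

theorem primrec_getD {β : Type*} [Primcodable β] (d : β) {l : α → List β} {f : α → ℕ}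
    (hl : Primrec l) (hf : Primrec f) : Primrec fun a => (l a).getD (f a) d :=
  (Primrec.list_getD d).comp hl hf

theorem primrec_notCellCode {l : α → List ℕ} {f : α → ℕ} (hl : Primrec l) (hf : Primrec f) :
    Primrec fun a => notCellCode (l a) (f a) :=
  primrec_foldr_impCode (primrec_map_range (Primrec.list_length.comp hl) <|
    primrec_signedCode (primrec_testBit (hf.comp Primrec.fst) Primrec.snd)
      (primrec_getD 0 (hl.comp Primrec.fst) Primrec.snd)) (.const _)

theorem primrec_allFmlCode {l : α → List ℕ} {f g : α → ℕ} (hf : Primrec f) (hg : Primrec g)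
    (hl : Primrec l) : Primrec fun a => allFmlCode (f a) (g a) (l a) := by
  have h2 : Primrec fun a => 2 ^ (l a).length :=
    primrec_pow (.const 2) (Primrec.list_length.comp hl)
  have hc : Primrec fun p : α × ℕ => notCellCode (l p.1) p.2 :=
    primrec_notCellCode (hl.comp Primrec.fst) Primrec.snd
  exact Primrec.list_append.comp
    (primrec_map_range h2 (primrec_allCode (hf.comp Primrec.fst) hc))
    (primrec_map_range h2
      (primrec_allCode (hf.comp Primrec.fst) (primrec_impCode (hg.comp Primrec.fst) hc)))

variable (B : BoolCodes)

theorem primrec_cellCode {f g : α → ℕ} (hf : Primrec f) (hg : Primrec g) :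
    Primrec fun a => B.cellCode (f a) (g a) := by
  have hv : Primrec fun p : α × ℕ => varCode p.2 := primrec_varCode Primrec.snd
  have hmap : Primrec fun a => (List.range (f a)).map fun i =>
      bif (g a).testBit i then varCode i else appCode 1 B.compl [varCode i] :=
    primrec_map_range hf (Primrec.cond (primrec_testBit (hg.comp Primrec.fst) Primrec.snd) hv
      (primrec_appCode (primrec_singleton hv)))
  have hinf : Primrec₂ fun (_ : α) (q : ℕ × ℕ) => appCode 1 B.inf [q.1, q.2] :=
    (primrec_appCode (Primrec.list_cons.comp (Primrec.fst.comp Primrec.snd)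
      (primrec_singleton (Primrec.snd.comp Primrec.snd)))).to₂
  exact Primrec.list_foldr hmap (.const _) hinf

theorem primrec_cellCondsCode {f : α → ℕ} (hf : Primrec f) :
    Primrec fun a => B.cellCondsCode (f a) := by
  have h2 : Primrec fun a => 2 ^ f a := primrec_pow (.const 2) hf
  have hf' : Primrec fun p : α × ℕ => f p.1 := hf.comp Primrec.fst
  have hc : Primrec fun p : α × ℕ => B.cellCode (f p.1) p.2 := primrec_cellCode B hf' Primrec.snd
  have hinf : ∀ {g : α × ℕ → ℕ}, Primrec g → Primrec fun p : α × ℕ =>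
      appCode 1 B.inf [B.cellCode (f p.1) p.2, varCode (f p.1 + g p)] := fun hg =>
    primrec_appCode (Primrec.list_cons.comp hc
      (primrec_singleton (primrec_varCode (Primrec.nat_add.comp hf' hg))))
  exact Primrec.list_append.comp
    (primrec_map_range h2 (primrec_eqCode (hinf Primrec.snd) (.const _)))
    (primrec_map_range h2 (primrec_appCode (primrec_singleton
      (hinf (Primrec.nat_add.comp (h2.comp Primrec.fst) Primrec.snd)))))

theorem primrec_relAllCode {f g : α → ℕ} {l : α → List ℕ} (hf : Primrec f) (hl : Primrec l)
    (hg : Primrec g) : Primrec fun a => B.relAllCode (f a) (l a) (g a) :=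
  Primrec.nat_iterate hf (primrec_foldr_impCode hl hg)
    (primrec_allCode (.const _) Primrec.snd).to₂

theorem primrec_shiftCode {f g h : α → ℕ} (hf : Primrec f) (hg : Primrec g) (hh : Primrec h) :
    Primrec fun a => B.shiftCode (f a) (g a) (h a) :=
  primrec_relAllCode B hg (primrec_map_range hg <| primrec_eqCode (primrec_varCode Primrec.snd) <|
    primrec_varCode (Primrec.nat_add.comp (hg.comp Primrec.fst)
      (Primrec.nat_add.comp (hf.comp Primrec.fst) Primrec.snd))) hh

theorem primrec_reductStep (p : ℕ × ℕ) :
    Primrec₂ fun (T : List ℕ) (prev : List (List ℕ × ℕ)) => reductStep B p T prev := by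
  have hn : Primrec fun a : List ℕ × List (List ℕ × ℕ) => a.2.length :=
    Primrec.list_length.comp Primrec.snd
  have hk : Primrec fun a : List ℕ × List (List ℕ × ℕ) => a.2.length.unpair.1 :=
    Primrec.fst.comp (Primrec.unpair.comp hn)
  have hk' : Primrec fun a : List ℕ × List (List ℕ × ℕ) => a.2.length.unpair.2.unpair :=
    Primrec.unpair.comp (Primrec.snd.comp (Primrec.unpair.comp hn))
  have hi := Primrec.fst.comp hk'
  have hR₁ := primrec_getD ([], 0) Primrec.snd hi
  have hR₂ := primrec_getD ([], 0) Primrec.snd (Primrec.snd.comp hk')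
  have hl₁ := Primrec.fst.comp hR₁
  have hl₂ := Primrec.fst.comp hR₂
  have hm₂ := Primrec.list_length.comp hl₂
  refine Primrec.ite (Primrec.eq.comp hk (.const 0)) (.const _)
    (Primrec.ite (Primrec.eq.comp hk (.const 3)) ?_
      (Primrec.ite (Primrec.eq.comp hk (.const 4)) ?_ ?_))
  · exact Primrec.pair (Primrec.list_append.comp hl₁ hl₂) (primrec_impCode (Primrec.snd.comp hR₁)
      (primrec_shiftCode B (Primrec.list_length.comp hl₁) hm₂ (Primrec.snd.comp hR₂)))
  · exact Primrec.pair (primrec_allFmlCode hi (Primrec.ite (Primrec.eq.comp hi (.const _)) (.const _)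
      (primrec_getD 0 Primrec.fst hi)) hl₂)
      (primrec_relAllCode B hm₂ (primrec_cellCondsCode B hm₂) (Primrec.snd.comp hR₂))
  · exact Primrec.pair (primrec_singleton hn) (.const _)

/-- Course-of-values recursion becomes ordinary primitive recursion when the state is the list of
all earlier values. -/
theorem primrec_reductCode (p : ℕ × ℕ) :
    Primrec₂ fun (T : List ℕ) (n : ℕ) => reductCode B p T n := by
  have h : Primrec₂ fun (T : List ℕ) (n : ℕ) => reductCodes B p T n := by
    have := Primrec.nat_rec (Primrec.const ([] : List (List ℕ × ℕ)))
      (g := fun (T : List ℕ) (q : ℕ × List (List ℕ × ℕ)) => q.2 ++ [reductStep B p T q.2])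
      (Primrec.list_append.comp (Primrec.snd.comp Primrec.snd) (primrec_singleton
        ((primrec_reductStep B p).comp Primrec.fst (Primrec.snd.comp Primrec.snd)))).to₂
    refine this.of_eq fun T n => ?_
    induction n with
    | zero => rfl
    | succ n ih => simp only [reductCodes, ← ih]
  exact (primrec_reductStep B p).comp Primrec.fst h

end Primrec

/-! ### The codes are those of the reducts -/

section CodeCorrectness

variable {S : Type u} {L : Lang.{u, v} S} {𝓛 : Lang.{0, v'} Unit} (b : BoolSymbols 𝓛)
  (Ψ : ∀ τ : S, Formula L (fun _ : Fin 1 => τ)) (N : Numbering L) (N' : Numbering 𝓛)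

theorem ofFn_eq_map_range {β : Type*} {m : ℕ} (f : Fin m → β) (g : ℕ → β)
    (h : ∀ i : Fin m, f i = g i) : List.ofFn f = (List.range m).map g := by
  apply List.ext_getElem
  · simp
  · intro i h₁ h₂
    simp [h]

theorem ofFn_append {β γ : Type*} {m₁ m₂ : ℕ} (f : Fin m₁ → β) (g : Fin m₂ → β) (F : β → γ) :
    (List.ofFn fun k => F (Fin.append f g k)) =
      (List.ofFn fun k => F (f k)) ++ List.ofFn fun k => F (g k) := by
  rw [← List.ofFn_fin_append]
  congr 1
  funext k
  refine Fin.addCases (fun k => ?_) (fun k => ?_) k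
  · rw [Fin.append_left, Fin.append_left]
  · rw [Fin.append_right, Fin.append_right]

theorem termCode_infT {n : ℕ} (t₁ t₂ : BTerm 𝓛 n) :
    N'.termCode (b.infT t₁ t₂) =
      appCode 1 (b.codes N').inf [N'.termCode t₁, N'.termCode t₂] := rfl

theorem termCode_cell {m n : ℕ} (h : m ≤ n) (J : ℕ) :
    N'.termCode (b.cell h J) = (b.codes N').cellCode m J := by
  have key : ∀ l : List (BTerm 𝓛 n), N'.termCode (l.foldr b.infT b.topT) =
      (l.map N'.termCode).foldr (fun s t => appCode 1 (b.codes N').inf [s, t])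
        (appCode 1 (b.codes N').top []) := by
    intro l
    induction l with
    | nil => rfl
    | cons t l ih => rw [List.foldr_cons, termCode_infT, ih]; rfl
  refine (key _).trans ?_
  rw [List.map_ofFn]
  refine congrArg (List.foldr _ _) (ofFn_eq_map_range _ _ fun i => ?_)
  simp only [Function.comp]
  cases J.testBit i <;> rfl

theorem code_cellAll {m : ℕ} (θ : BFormula 𝓛 m) : N'.code (b.cellAll θ) =
    (b.codes N').relAllCode m ((b.codes N').cellCondsCode m) (N'.code θ) := by
  refine (N'.code_relAll _ _ _).trans ?_
  rw [cellConds, List.map_append, List.map_ofFn, List.map_ofFn]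
  refine congrArg (fun l : List ℕ => (b.codes N').relAllCode m l (N'.code θ)) (congrArg₂ _ ?_ ?_)
  · refine ofFn_eq_map_range _ _ fun J => ?_
    change eqCode (appCode _ _ [N'.termCode (b.cell (Nat.le_add_left m (2 ^ m + 2 ^ m)) J), _]) _ = _
    rw [termCode_cell]
    rfl
  · refine ofFn_eq_map_range _ _ fun J => ?_
    change appCode _ _ [appCode _ _ [N'.termCode (b.cell (Nat.le_add_left m (2 ^ m + 2 ^ m)) J), _]] = _
    rw [termCode_cell]
    rfl

theorem code_shift {k m : ℕ} (θ : BFormula 𝓛 m) :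
    N'.code (shift k θ) = (b.codes N').shiftCode k m (N'.code θ) := by
  refine (N'.code_relAll _ _ _).trans ?_
  rw [List.map_ofFn]
  exact congrArg (fun l : List ℕ => (b.codes N').relAllCode m l (N'.code θ)) (ofFn_eq_map_range _ _ fun i => rfl)

theorem code_notCell {n m : ℕ} {Γ : Fin n → S} (ψ : Fin m → Formula L Γ) (J : ℕ) :
    N.code (Formula.notCell ψ J) = notCellCode (List.ofFn fun k => N.code (ψ k)) J := by
  refine (N.code_impList _ _).trans ?_
  rw [List.map_ofFn, notCellCode, List.length_ofFn]
  refine congrArg (List.foldr _ _) (ofFn_eq_map_range _ _ fun i => ?_)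
  refine (N.code_signed _ _).trans (congrArg _ ?_)
  simp

theorem code_allFml {n : ℕ} {Γ : Fin n → S} {τ : S} (R : Reduct L 𝓛 (consCtx τ Γ)) :
    (List.ofFn fun k => N.code (R.allFml Ψ τ k)) =
      allFmlCode (N.sort τ) (N.code (Ψ τ)) (List.ofFn fun k => N.code (R.fml k)) := by
  rw [Reduct.allFml, ofFn_append, allFmlCode, List.length_ofFn]
  refine congrArg₂ _ ?_ ?_
  · refine ofFn_eq_map_range _ _ fun J => ?_
    rw [← code_notCell]
    rfl
  · refine ofFn_eq_map_range _ _ fun J => ?_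
    rw [← code_notCell, ← N.code_weaken (Ψ τ)]
    rfl

variable (B : BoolCodes) (p : ℕ × ℕ) (T : List ℕ)

theorem length_reductCodes (n : ℕ) : (reductCodes B p T n).length = n := by
  induction n with
  | zero => rfl
  | succ n ih => simp [reductCodes, ih]

theorem getD_reductCodes {k n : ℕ} (h : k < n) (d : List ℕ × ℕ) :
    (reductCodes B p T n).getD k d = reductCode B p T k := by
  induction n with
  | zero => exact absurd h (Nat.not_lt_zero k)
  | succ n ih =>
    rw [reductCodes]
    rcases Nat.lt_succ_iff_lt_or_eq.1 h with h' | rfl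
    · rw [List.getD_append _ _ _ _ (by rwa [length_reductCodes]), ih h']
    · rw [List.getD_append_right _ _ _ _ (by rw [length_reductCodes]), length_reductCodes]
      simp [reductCode]

theorem le_pair_left (k i j : ℕ) : i ≤ Nat.pair k (Nat.pair i j) :=
  (Nat.left_le_pair _ _).trans (Nat.right_le_pair _ _)

theorem le_pair_right (k i j : ℕ) : j ≤ Nat.pair k (Nat.pair i j) :=
  (Nat.right_le_pair _ _).trans (Nat.right_le_pair _ _)

/-- A pair is at least the sum of its entries. Positivity of the tag gives the strict inequality
that places the reduct of a subformula in `prev`. -/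
theorem lt_pair_left {k : ℕ} (hk : 0 < k) (i j : ℕ) : i < Nat.pair k (Nat.pair i j) := by
  have := Nat.add_le_pair k (Nat.pair i j)
  have := Nat.left_le_pair i j
  omega

theorem lt_pair_right {k : ℕ} (hk : 0 < k) (i j : ℕ) : j < Nat.pair k (Nat.pair i j) := by
  have := Nat.add_le_pair k (Nat.pair i j)
  have := Nat.right_le_pair i j
  omega

theorem reductCode_imp (c d : ℕ) : reductCode B p T (impCode c d) =
    ((reductCode B p T c).1 ++ (reductCode B p T d).1,
      impCode (reductCode B p T c).2 (B.shiftCode (reductCode B p T c).1.length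
        (reductCode B p T d).1.length (reductCode B p T d).2)) := by
  rw [impCode, reductCode, reductStep]
  simp only [length_reductCodes, Nat.unpair_pair, OfNat.ofNat_ne_zero, if_false, if_true]
  rw [getD_reductCodes B p T (lt_pair_left three_pos c d),
    getD_reductCodes B p T (lt_pair_right three_pos c d)]

theorem reductCode_all (i c : ℕ) : reductCode B p T (allCode i c) =
    (allFmlCode i (if i = p.1 then p.2 else T.getD i 0) (reductCode B p T c).1,
      B.relAllCode (reductCode B p T c).1.length
        (B.cellCondsCode (reductCode B p T c).1.length) (reductCode B p T c).2) := by
  rw [allCode, reductCode, reductStep]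
  simp only [length_reductCodes, Nat.unpair_pair, OfNat.ofNat_ne_zero, if_false, if_true,
    getD_reductCodes B p T (lt_pair_right four_pos i c)]
  rfl

theorem reductCode_atom {k : ℕ} (hk : k = 1 ∨ k = 2) (c : ℕ) :
    reductCode B p T (Nat.pair k c) =
      ([Nat.pair k c], eqCode (varCode 0) (appCode 1 B.top [])) := by
  rw [reductCode, reductStep]
  rcases hk with rfl | rfl <;> simp [length_reductCodes]

theorem reductCode_falsum : reductCode B p T (Nat.pair 0 0) = ([], Nat.pair 0 0) := by
  rw [reductCode, reductStep]
  simp [length_reductCodes]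

variable {p T}

/-- The function `reductCode` computes the reducts of formulas, on Gödel numbers. -/
theorem reductCode_code {bd : ℕ}
    (hT : ∀ τ, N.sort τ ≤ bd →
      N.code (Ψ τ) = if N.sort τ = p.1 then p.2 else T.getD (N.sort τ) 0)
    {n : ℕ} {Γ : Fin n → S} (φ : Formula L Γ) (hφ : N.code φ ≤ bd) :
    reductCode (b.codes N') p T (N.code φ) =
      (List.ofFn fun k => N.code ((reduct b Ψ φ).fml k), N'.code (reduct b Ψ φ).bool) := by
  induction φ with
  | falsum => exact reductCode_falsum _ p T
  | eq t₁ t₂ => exact reductCode_atom _ _ _ (Or.inl rfl) _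
  | rel R ts => exact reductCode_atom _ _ _ (Or.inr rfl) _
  | imp φ₁ φ₂ ih₁ ih₂ =>
    refine (reductCode_imp _ p T _ _).trans ?_
    rw [ih₁ ((le_pair_left _ _ _).trans hφ), ih₂ ((le_pair_right _ _ _).trans hφ),
      List.length_ofFn, List.length_ofFn, ← code_shift]
    refine Prod.ext ?_ ?_
    · exact (ofFn_append (reduct b Ψ φ₁).fml (reduct b Ψ φ₂).fml N.code).symm
    · exact congrArg (impCode · _) (N'.code_weaken _ _ _).symm
  | all τ φ ih =>
    refine (reductCode_all _ p T _ _).trans ?_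
    rw [ih ((le_pair_right _ _ _).trans hφ), List.length_ofFn, ← code_cellAll,
      ← hT τ ((le_pair_left _ _ _).trans hφ), ← code_allFml]
    rfl

end CodeCorrectness

/-! ### Oracle computations with lists -/

section Oracle

theorem getD_map_range (g : ℕ → ℕ) {i n : ℕ} (h : i < n) :
    ((List.range n).map g).getD i 0 = g i := by
  simp [List.getD_eq_getElem?_getD, h]

/-- A function on the natural numbers that is computable with oracles in `O`. -/
def TotalIn (O : Set (ℕ →. ℕ)) (f : ℕ → ℕ) : Prop := Nat.RecursiveIn O fun n => Part.some (f n)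

namespace TotalIn

variable {O : Set (ℕ →. ℕ)} {f g : ℕ → ℕ}

theorem of_primrec (hf : Primrec f) : TotalIn O f := (Primrec.nat_iff.1 hf).recursiveIn

theorem oracle (h : (f : ℕ →. ℕ) ∈ O) : TotalIn O f := Nat.RecursiveIn.oracle _ h

theorem comp (hf : TotalIn O f) (hg : TotalIn O g) : TotalIn O fun n => f (g n) :=
  (Nat.RecursiveIn.comp hf hg).of_eq fun _ => Part.bind_some _ _

theorem pair (hf : TotalIn O f) (hg : TotalIn O g) : TotalIn O fun n => Nat.pair (f n) (g n) :=
  (Nat.RecursiveIn.pair hf hg).of_eq fun n => by simp [Seq.seq]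

/-- The table of the first values of a function can be computed from the function. -/
theorem table (hg : TotalIn O g) : TotalIn O fun n => encode ((List.range n).map g) := by
  let snoc : ℕ → ℕ := fun z =>
    encode ((decode (α := List ℕ) z.unpair.1).getD [] ++ [z.unpair.2])
  have hsnoc : Primrec snoc := by
    have h₁ : Primrec fun z : ℕ => (decode (α := List ℕ) z.unpair.1).getD [] :=
      Primrec.option_getD.comp (Primrec.decode.comp (Primrec.fst.comp Primrec.unpair)) (.const [])
    exact Primrec.encode.comp (Primrec.list_append.comp h₁
      (primrec_singleton (Primrec.snd.comp Primrec.unpair)))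
  -- In the recursion step z codes (parameter, (counter, previous value)); `hy` extracts the counter
  -- and `hi` the list built so far. The parameter is a dummy, set to 0 in `hin`.
  have hy : TotalIn O fun z => z.unpair.2.unpair.1 :=
    of_primrec (Primrec.fst.comp (Primrec.unpair.comp (Primrec.snd.comp Primrec.unpair)))
  have hi : TotalIn O fun z => z.unpair.2.unpair.2 :=
    of_primrec (Primrec.snd.comp (Primrec.unpair.comp (Primrec.snd.comp Primrec.unpair)))
  have hstep := (of_primrec (O := O) hsnoc).comp (hi.pair (hg.comp hy))
  have hrec := Nat.RecursiveIn.prec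
    (of_primrec (O := O) (Primrec.const (encode ([] : List ℕ)))) hstep
  have hin : TotalIn O fun n => Nat.pair 0 n :=
    of_primrec (primrec_natPair (.const 0) .id)
  refine (Nat.RecursiveIn.comp hrec hin).of_eq fun n => ?_
  refine (Part.bind_some _ _).trans ?_
  simp only [Nat.unpair_pair]
  induction n with
  | zero => rfl
  | succ n ih =>
    simp only [ih]
    refine (Part.bind_some _ _).trans ?_
    simp [snoc, List.range_succ]

/-- Applying a function to all elements of a list, on codes. -/
theorem map (hg : TotalIn O g) :
    TotalIn O fun n => encode (((decode (α := List ℕ) n).getD []).map g) := by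
  have hl : Primrec fun n : ℕ => (decode (α := List ℕ) n).getD [] :=
    Primrec.option_getD.comp Primrec.decode (.const [])
  -- One plus the sum of the entries exceeds every entry, so a table of g up to this bound reduces
  -- the map to primitive recursive lookups.
  have hbd : Primrec fun n : ℕ => ((decode (α := List ℕ) n).getD []).foldr (· + ·) 1 :=
    Primrec.list_foldr hl (.const 1) (Primrec.nat_add.comp (Primrec.fst.comp Primrec.snd)
      (Primrec.snd.comp Primrec.snd)).to₂
  have hlook : Primrec fun z : ℕ => encode (((decode (α := List ℕ) z.unpair.1).getD []).map
      fun d => ((decode (α := List ℕ) z.unpair.2).getD []).getD d 0) :=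
    Primrec.encode.comp (Primrec.list_map (hl.comp (Primrec.fst.comp Primrec.unpair))
      (primrec_getD 0 (hl.comp (Primrec.snd.comp (Primrec.unpair.comp Primrec.fst)))
        Primrec.snd).to₂)
  have key : ∀ l : List ℕ, ∀ d ∈ l, d < l.foldr (· + ·) 1 := by
    intro l
    induction l with
    | nil => simp
    | cons e l ih =>
      intro d hd
      rw [List.foldr_cons]
      have h0 : ∀ l : List ℕ, 0 < l.foldr (· + ·) 1 := fun l => by
        induction l with
        | nil => simp
        | cons e l ih => rw [List.foldr_cons]; omega
      have := h0 l
      rcases List.mem_cons.1 hd with rfl | hd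
      · omega
      · have := ih d hd
        omega
  refine Nat.RecursiveIn.of_eq ((of_primrec hlook).comp
    ((of_primrec Primrec.id).pair (hg.table.comp (of_primrec hbd)))) fun n => ?_
  simp only [Nat.unpair_pair, encodek, Option.getD_some, id]
  refine congrArg (fun l : List ℕ => Part.some (encode l)) (List.map_congr_left fun d hd => ?_)
  exact getD_map_range g (key _ d hd)

end TotalIn

end Oracle

/-! ### The effective reduction -/

section Effectivity

/-- The codes of the formulas `ψ i` in context and of `θ`, computed from the code `z.unpair.1` of a
formula in context and from the table `z.unpair.2` of the codes of the formulas used in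
the restriction. -/
def reductInCtx (B : BoolCodes) (p : ℕ × ℕ) (z : ℕ) : ℕ :=
  let R := reductCode B p ((decode (α := List ℕ) z.unpair.2).getD []) z.unpair.1.unpair.2
  -- Inputs for the eliminations carry contexts: that of ψ for each component, and a list of m
  -- copies of the Boolean sort for θ.
  Nat.pair (encode (R.1.map (Nat.pair z.unpair.1.unpair.1)))
    (Nat.pair (encode (R.1.map fun _ => B.sort)) R.2)

theorem primrec_reductInCtx (B : BoolCodes) (p : ℕ × ℕ) : Primrec (reductInCtx B p) := by
  have hx : Primrec fun z : ℕ => z.unpair.1.unpair :=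
    Primrec.unpair.comp (Primrec.fst.comp Primrec.unpair)
  have hT : Primrec fun z : ℕ => (decode (α := List ℕ) z.unpair.2).getD [] :=
    Primrec.option_getD.comp (Primrec.decode.comp (Primrec.snd.comp Primrec.unpair)) (.const [])
  have hR : Primrec fun z : ℕ => reductCode B p ((decode (α := List ℕ) z.unpair.2).getD [])
      z.unpair.1.unpair.2 :=
    (primrec_reductCode B p).comp hT (Primrec.snd.comp hx)
  have hl := Primrec.fst.comp hR
  exact primrec_natPair
    (Primrec.encode.comp (Primrec.list_map hl (primrec_natPair
      ((Primrec.fst.comp hx).comp Primrec.fst) Primrec.snd).to₂))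
    (primrec_natPair (Primrec.encode.comp (Primrec.list_map hl (Primrec.const B.sort).to₂))
      (Primrec.snd.comp hR))

/-- The reduction followed by the two quantifier eliminations `g` and `g'`, on codes; the formulas
used in the restriction are given by `h`. -/
def reductionVia (B : BoolCodes) (p : ℕ × ℕ) (g g' h : ℕ → ℕ) (n : ℕ) : ℕ :=
  -- The number n bounds the codes of all sorts quantified over in the formula, so this finite table
  -- of h suffices.
  let z := reductInCtx B p (Nat.pair n (encode ((List.range (n + 1)).map h)))
  Nat.pair (encode (((decode (α := List ℕ) z.unpair.1).getD []).map g)) (g' z.unpair.2)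

theorem computableIn_reductionVia (B : BoolCodes) (p : ℕ × ℕ) (g g' h : ℕ → ℕ) :
    ComputableIn {(g : ℕ →. ℕ), (g' : ℕ →. ℕ), (h : ℕ →. ℕ)} (reductionVia B p g g' h) := by
  set O : Set (ℕ →. ℕ) := {(g : ℕ →. ℕ), (g' : ℕ →. ℕ), (h : ℕ →. ℕ)}
  have hg : TotalIn O g := .oracle (by simp [O])
  have hg' : TotalIn O g' := .oracle (by simp [O])
  have hh : TotalIn O h := .oracle (by simp [O])
  have hz : TotalIn O fun n =>
      reductInCtx B p (Nat.pair n (encode ((List.range (n + 1)).map h))) :=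
    (TotalIn.of_primrec (primrec_reductInCtx B p)).comp
      ((TotalIn.of_primrec Primrec.id).pair (hh.table.comp (TotalIn.of_primrec Primrec.succ)))
  exact RecursiveIn.iff_nat.2 ((hg.map.comp
    ((TotalIn.of_primrec (Primrec.fst.comp Primrec.unpair)).comp hz)).pair
    (hg'.comp ((TotalIn.of_primrec (Primrec.snd.comp Primrec.unpair)).comp hz)))

end Effectivity

end AdelicQE

/-! ### Combining the reduction with the two eliminations -/

theorem theorem7p1 (K : Type t) [Field K] [NumberField K]
    -- the language `L`, with a field sort `fld` carrying the language of rings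
    {S : Type u} (L : ManySorted.Lang.{u, v} S) (fld : S) (r : AdelicQE.RingSymbols L fld)
    -- the non-archimedean completions `K_v` as `L`-structures
    (M : HeightOneSpectrum (𝓞 K) → S → Type w) (s : ∀ v, ManySorted.Struc L (M v))
    (e : ∀ v, M v fld ≃ v.adicCompletion K) (hr : ∀ v, r.Standard (s v) (e v))
    -- the formulas by which the product is restricted in the sorts other than `fld`
    (Φ : ∀ τ : S, ManySorted.Formula L (fun _ : Fin 1 => τ))
    (hΦ : ManySorted.AlmostClosed s (AdelicQE.restrictTo s e Φ))
    -- uniform quantifier elimination in the sort `σ`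
    (σ : S) (hσ : ManySorted.UniformQE σ s)
    -- the Boolean language and quantifier elimination for the enriched power set
    (𝓛 : ManySorted.Lang.{0, v'} Unit) (b : AdelicQE.BoolSymbols 𝓛)
    (P : ManySorted.Struc 𝓛 fun _ => Set (HeightOneSpectrum (𝓞 K))) (hb : b.IsPowerset P)
    (hP : ManySorted.UniformQE () fun _ : Unit => P) :
    (∀ (n : ℕ) (Γ : Fin n → S) (ψ : ManySorted.Formula L Γ),
      ∃ (m : ℕ) (ψ' : Fin m → ManySorted.Formula L Γ)
        (θ : ManySorted.Formula 𝓛 (fun _ : Fin m => ())),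
        (∀ i, (ψ' i).QuantFreeIn σ) ∧ θ.QuantFreeIn () ∧
        AdelicQE.IsReduction s e Φ hΦ P ψ ψ' θ) ∧
    -- effectivity, relative to any two procedures for the two quantifier eliminations
    -- and to the assignment of `Φ τ` to `τ`
    (∀ (N : ManySorted.Numbering L) (N' : ManySorted.Numbering 𝓛) (g g' h : ℕ → ℕ),
      N.EliminatesVia σ s g → N'.EliminatesVia () (fun _ : Unit => P) g' →
      (∀ τ, τ ≠ fld → h (N.sort τ) = N.code (Φ τ)) →
      ∃ f : ℕ → ℕ, ComputableIn {(g : ℕ →. ℕ), (g' : ℕ →. ℕ), (h : ℕ →. ℕ)} f ∧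
        ∀ (n : ℕ) (Γ : Fin n → S) (ψ : ManySorted.Formula L Γ),
          ∃ (m : ℕ) (ψ' : Fin m → ManySorted.Formula L Γ)
            (θ : ManySorted.Formula 𝓛 (fun _ : Fin m => ())),
            f (N.codeInCtx ψ) =
              Nat.pair (Encodable.encode (List.ofFn fun i => N.code (ψ' i))) (N'.code θ) ∧
            (∀ i, (ψ' i).QuantFreeIn σ) ∧ θ.QuantFreeIn () ∧
            AdelicQE.IsReduction s e Φ hΦ P ψ ψ' θ) := by
  set Ψ := AdelicQE.restrictF r Φ
  have hred : ∀ (n : ℕ) (Γ : Fin n → S) (ψ : ManySorted.Formula L Γ),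
      (AdelicQE.reduct b Ψ ψ).Represents hΦ P ψ := fun n Γ ψ =>
    AdelicQE.represents_reduct b Ψ hΦ hb (AdelicQE.realize_restrictF r Φ hr) ψ
  -- Uniformly equivalent components have the same Boolean values, so both eliminations may be
  -- applied to the finished reduct.
  have hQE : ∀ (n : ℕ) (Γ : Fin n → S) (ψ : ManySorted.Formula L Γ)
      (ψ' : Fin (AdelicQE.reduct b Ψ ψ).m → ManySorted.Formula L Γ)
      (θ : ManySorted.Formula 𝓛 (fun _ : Fin (AdelicQE.reduct b Ψ ψ).m => ())),
      (∀ k v a, (ψ' k).Realize (s v) a ↔ ((AdelicQE.reduct b Ψ ψ).fml k).Realize (s v) a) →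
      (∀ a, θ.Realize P a ↔ (AdelicQE.reduct b Ψ ψ).bool.Realize P a) →
      AdelicQE.IsReduction s e Φ hΦ P ψ ψ' θ := by
    intro n Γ ψ ψ' θ hψ' hθ a
    refine (hred n Γ ψ a).trans ((hθ _).symm.trans (iff_of_eq (congrArg (θ.Realize P) ?_)))
    funext k
    exact Set.ext fun v => (hψ' k v _).symm
  refine ⟨fun n Γ ψ => ?_, fun N N' g g' h hg hg' hh =>
    -- The oracle h is unspecified at the field sort; the code of the ring formula used there is a
    -- fixed number built into the algorithm.
    ⟨AdelicQE.reductionVia (b.codes N') (N.sort fld, N.code (Ψ fld)) g g' h,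
      AdelicQE.computableIn_reductionVia _ _ g g' h, fun n Γ ψ => ?_⟩⟩
  · choose ψ' hψ' using fun k => hσ n Γ ((AdelicQE.reduct b Ψ ψ).fml k)
    obtain ⟨θ, hθ, hθ'⟩ := hP _ _ (AdelicQE.reduct b Ψ ψ).bool
    exact ⟨_, ψ', θ, fun k => (hψ' k).1, hθ,
      hQE n Γ ψ ψ' θ (fun k => (hψ' k).2) fun a => hθ' () a⟩
  · choose ψ' hψ' using fun k => hg n Γ ((AdelicQE.reduct b Ψ ψ).fml k)
    obtain ⟨θ, hθc, hθ, hθ'⟩ := hg' _ _ (AdelicQE.reduct b Ψ ψ).bool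
    refine ⟨_, ψ', θ, ?_, fun k => (hψ' k).2.1, hθ,
      hQE n Γ ψ ψ' θ (fun k => (hψ' k).2.2) fun a => hθ' () a⟩
    have hcode := AdelicQE.reductCode_code b Ψ N N' (p := (N.sort fld, N.code (Ψ fld)))
      (T := (List.range (N.codeInCtx ψ + 1)).map h) (bd := N.codeInCtx ψ) (fun τ hτ => by
        by_cases hτf : τ = fld
        · subst hτf
          rw [if_pos rfl]
        · rw [if_neg fun h' => hτf (N.sort.injective h'),
            AdelicQE.getD_map_range h (Nat.lt_succ_of_le hτ), hh τ hτf]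
          simp only [Ψ, AdelicQE.restrictF, dif_neg hτf]) ψ (Nat.right_le_pair _ _)
    have hz : (N.codeInCtx ψ).unpair = (N.ctxCode Γ, N.code ψ) := Nat.unpair_pair _ _
    simp only [AdelicQE.reductionVia, AdelicQE.reductInCtx, Nat.unpair_pair, Encodable.encodek,
      Option.getD_some, hz, hcode, List.map_ofFn]
    refine congrArg₂ Nat.pair (congrArg _ (congrArg _ (funext fun k => (hψ' k).1))) ?_
    rw [← hθc]
    exact congrArg g' rfl
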